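/- Let $N\ge 2$, let $\omega\subset\mathbb R^{N-1}$ be a bounded smooth domain, $\ell>0$, $Q=\omega\times]-\ell,\ell[$, $k>0$, $\gamma\in\mathbb R$, and let $Y'=]0,1[^{N-1}$, $Y=]0,1[^N$. Let $g:\mathbb R^{N-1}\to\mathbb R$ be positive, $Y'$-periodic and Lipschitz continuous. For $\varepsilon>0$ write $x=(x',x_N)$ and set $$\Gamma^\varepsilon=\{x\in Q: x_N=\varepsilon^k g(x'/\varepsilon)\},\qquad Q_\varepsilon^{+}=\{x\in Q: x_N>\varepsilon^k g(x'/\varepsilon)\},\qquad Q_\varepsilon^{-}=\{x\in Q: x_N<\varepsilon^k g(x'/\varepsilon)\}.$$ Let $A$ be a measurable, $Y$-periodic field of real $N\times N$ matrices on $\mathbb R^N$ such that, for some constants $0<\alpha<\beta$, $(A(y)\lambda,\lambda)\ge\alpha|\lambda|^2$ and $|A(y)\lambda|\le\beta|\lambda|$ for a.e. $y\in Y$ and all $\lambda\in\mathbb R^N$; let $h\in L^\infty(\mathbb R^{N-1})$ be $Y'$-periodic with $h>h_0$ a.e. on $Y'$ for some constant $h_0>0$; and let $f\in L^2(Q)$.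 Put $A^\varepsilon(x)=A(x/\varepsilon)$ and $h^\varepsilon(x')=h(x'/\varepsilon)$. For a function $v$ on $Q$ let $v_\varepsilon^\pm$ be its restriction to $Q_\varepsilon^\pm$. Let $$W_0^\varepsilon=\{v\in L^2(Q): v_\varepsilon^\pm\in H^1(Q_\varepsilon^\pm),\ v=0\text{ on }\partial Q\},$$ where $v=0$ on $\partial Q$ is understood in the sense of traces. For $v\in W_0^\varepsilon$ let $\nabla v$ be the function equal to $\nabla v_\varepsilon^\pm$ in $Q_\varepsilon^\pm$, and let $[v]=v_\varepsilon^+-v_\varepsilon^-$ be the jump of the traces on $\Gamma^\varepsilon$; let $\sigma$ be the surface measure on $\Gamma^\varepsilon$. Set $$K^\varepsilon_\gamma=\{v\in W_0^\varepsilon: [v]\ge 0\ \ \sigma\text{-a.e. on }\Gamma^\varepsilon\}.$$ **Theorem.** There is a constant $C>0$, independent of $\varepsilon$, such that for every $\varepsilon>0$ with $\varepsilon^k g(x'/\varepsilon)<\ell$ for all $x'\in\overline\omega$ there exists a unique $u_\varepsilon\in K^\varepsilon_\gamma$ satisfying $$\int_{Q\setminus\Gamma^\varepsilon}A^\varepsilon\nabla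 u_\varepsilon\cdot(\nabla v-\nabla u_\varepsilon)\,dx+\varepsilon^\gamma\int_{\Gamma^\varepsilon}h^\varepsilon[u_\varepsilon]\,([v]-[u_\varepsilon])\,d\sigma\ \ge\ \int_Q f\,(v-u_\varepsilon)\,dx\qquad\forall\,v\in K^\varepsilon_\gamma,$$ and this $u_\varepsilon$ satisfies $$\|\nabla u_\varepsilon\|_{L^2(Q\setminus\Gamma^\varepsilon)}\le C,\qquad \|[u_\varepsilon]\|_{L^2(\Gamma^\varepsilon)}\le C\,\varepsilon^{-\gamma/2}.$$ -/

import Mathlib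

open MeasureTheory Filter Topology Set
open scoped ENNReal Gradient

namespace Signorini

noncomputable section

/-- Euclidean space `ℝ^d`. -/
abbrev Rn (d : ℕ) : Type := EuclideanSpace ℝ (Fin d)

/-- The horizontal part `x' = (x_1, …, x_{N-1})` of a point `x ∈ ℝ^N`, with `N = n + 1`. -/
def horiz {n : ℕ} (x : Rn (n + 1)) : Rn n := WithLp.toLp 2 (fun i : Fin n => x i.castSucc)

/-- The vertical coordinate `x_N` of a point `x ∈ ℝ^N`, with `N = n + 1`. -/
def vert {n : ℕ} (x : Rn (n + 1)) : ℝ := x (Fin.last n)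

/-- Bounded smooth domain: a nonempty, bounded, connected open set which near each of its boundary
points is the sublevel set `{ρ < 0}` of a smooth function `ρ` with nonvanishing gradient there. -/
structure IsBoundedSmoothDomain {d : ℕ} (ω : Set (Rn d)) : Prop where
  isOpen : IsOpen ω
  isConnected : IsConnected ω
  isBounded : Bornology.IsBounded ω
  smooth_boundary : ∀ p ∈ frontier ω, ∃ ρ : Rn d → ℝ,
    ContDiff ℝ (⊤ : ℕ∞) ρ ∧ ρ p = 0 ∧ ∇ ρ p ≠ 0 ∧ ∀ᶠ x in 𝓝 p, (x ∈ ω ↔ ρ x < 0)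

/-- The open unit cell `]0,1[^d`. -/
def unitCell (d : ℕ) : Set (Rn d) := {y | ∀ i, y i ∈ Ioo (0 : ℝ) 1}

/-- Periodicity with respect to the unit cell, for functions defined almost everywhere. -/
def IsAEPeriodic {d : ℕ} {β : Type*} (F : Rn d → β) : Prop :=
  ∀ i : Fin d, ∀ᵐ y : Rn d, F (y + EuclideanSpace.single i 1) = F y

/-! ### Geometry -/

/-- The cylinder `Q = ω × ]-ℓ, ℓ[`. -/
def cyl {n : ℕ} (ω : Set (Rn n)) (ℓ : ℝ) : Set (Rn (n + 1)) :=
  {x | horiz x ∈ ω ∧ vert x ∈ Ioo (-ℓ) ℓ}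

/-- The height `ε^k g(x'/ε)` of the oscillating interface above the point `x'`. -/
def height {n : ℕ} (g : Rn n → ℝ) (k ε : ℝ) (x' : Rn n) : ℝ := ε ^ k * g (ε⁻¹ • x')

/-- The oscillating interface `Γ^ε`. -/
def interface {n : ℕ} (ω : Set (Rn n)) (ℓ : ℝ) (g : Rn n → ℝ) (k ε : ℝ) : Set (Rn (n + 1)) :=
  {x ∈ cyl ω ℓ | vert x = height g k ε (horiz x)}

/-- The upper part `Q_ε^+` of `Q`. -/
def upper {n : ℕ} (ω : Set (Rn n)) (ℓ : ℝ) (g : Rn n → ℝ) (k ε : ℝ) : Set (Rn (n + 1)) :=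
  {x ∈ cyl ω ℓ | height g k ε (horiz x) < vert x}

/-- The lower part `Q_ε^-` of `Q`. -/
def lower {n : ℕ} (ω : Set (Rn n)) (ℓ : ℝ) (g : Rn n → ℝ) (k ε : ℝ) : Set (Rn (n + 1)) :=
  {x ∈ cyl ω ℓ | vert x < height g k ε (horiz x)}

/-- The `(N-1)`-dimensional surface measure on a subset `S` of `ℝ^N`, `N = n + 1`: the Hausdorff
measure normalized so as to coincide with Lebesgue measure on hyperplanes. -/
def surf {n : ℕ} (S : Set (Rn (n + 1))) : Measure (Rn (n + 1)) := (μHE[n]).restrict S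

/-! ### Sobolev functions and traces -/

/-- `F ∈ L²(Ω; ℝ^d)` is the weak gradient in `Ω` of `v ∈ L²(Ω)`. -/
structure IsWeakGrad {d : ℕ} (Ω : Set (Rn d)) (v : Rn d → ℝ) (F : Rn d → Rn d) : Prop where
  memLp : MemLp v 2 (volume.restrict Ω)
  memLp_grad : MemLp F 2 (volume.restrict Ω)
  integral_eq : ∀ φ : Rn d → ℝ, ContDiff ℝ (⊤ : ℕ∞) φ → HasCompactSupport φ → tsupport φ ⊆ Ω →
    ∫ x in Ω, v x • ∇ φ x = -∫ x in Ω, φ x • F x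

/-- `v ∈ H¹(Ω)`. -/
def MemH1 {d : ℕ} (Ω : Set (Rn d)) (v : Rn d → ℝ) : Prop := ∃ F, IsWeakGrad Ω v F

open Classical in
/-- The weak gradient in `Ω` of a function `v ∈ H¹(Ω)` (unique a.e. in `Ω`). -/
def weakGrad {d : ℕ} (Ω : Set (Rn d)) (v : Rn d → ℝ) : Rn d → Rn d :=
  if h : MemH1 Ω v then h.choose else 0

/-- `T ∈ L²(S)` is the trace on the part `S` of the boundary of `Ω` of the function `v ∈ H¹(Ω)`:
some functions smooth up to the boundary converge to `v` in `H¹(Ω)` while their restrictions to `S`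
converge to `T` in `L²(S)`. For a bounded Lipschitz domain `Ω`, where smooth functions are dense in
`H¹(Ω)`, this is the usual trace operator, i.e. the continuous extension of the restriction map. -/
structure IsTrace {n : ℕ} (Ω S : Set (Rn (n + 1))) (v T : Rn (n + 1) → ℝ) : Prop where
  memH1 : MemH1 Ω v
  memLp : MemLp T 2 (surf S)
  exists_approx : ∃ φ : ℕ → Rn (n + 1) → ℝ, (∀ m, ContDiff ℝ (⊤ : ℕ∞) (φ m)) ∧
    Tendsto (fun m => eLpNorm (φ m - v) 2 (volume.restrict Ω)) atTop (𝓝 0) ∧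
    Tendsto (fun m => eLpNorm (∇ (φ m) - weakGrad Ω v) 2 (volume.restrict Ω)) atTop (𝓝 0) ∧
    Tendsto (fun m => eLpNorm (φ m - T) 2 (surf S)) atTop (𝓝 0)

open Classical in
/-- The trace on `S` of a function `v ∈ H¹(Ω)`. -/
def trace {n : ℕ} (Ω S : Set (Rn (n + 1))) (v : Rn (n + 1) → ℝ) : Rn (n + 1) → ℝ :=
  if h : ∃ T, IsTrace Ω S v T then h.choose else 0

/-! ### The spaces and the weak formulation -/

/-- The space `L²(Q)`. -/
abbrev L2 {n : ℕ} (ω : Set (Rn n)) (ℓ : ℝ) : Type := Lp ℝ 2 (volume.restrict (cyl ω ℓ))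

/-- The space `W_0^ε`: functions of `L²(Q)` which are `H¹` on both sides of the interface and
whose trace on `∂Q` vanishes. -/
def W0 {n : ℕ} (ω : Set (Rn n)) (ℓ : ℝ) (g : Rn n → ℝ) (k ε : ℝ) : Set (L2 ω ℓ) :=
  {v | MemH1 (upper ω ℓ g k ε) v ∧ MemH1 (lower ω ℓ g k ε) v ∧
    IsTrace (upper ω ℓ g k ε) (frontier (cyl ω ℓ) ∩ frontier (upper ω ℓ g k ε)) v 0 ∧
    IsTrace (lower ω ℓ g k ε) (frontier (cyl ω ℓ) ∩ frontier (lower ω ℓ g k ε)) v 0}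

/-- The gradient of `v ∈ W_0^ε`: the sum of the zero extensions of the weak gradients of
`v_ε^+` and `v_ε^-`. -/
def grad {n : ℕ} (ω : Set (Rn n)) (ℓ : ℝ) (g : Rn n → ℝ) (k ε : ℝ) (v : Rn (n + 1) → ℝ) :
    Rn (n + 1) → Rn (n + 1) :=
  (upper ω ℓ g k ε).indicator (weakGrad (upper ω ℓ g k ε) v) +
    (lower ω ℓ g k ε).indicator (weakGrad (lower ω ℓ g k ε) v)

/-- The jump `[v] = v_ε^+ - v_ε^-` on `Γ^ε`, in the sense of traces. -/
def jump {n : ℕ} (ω : Set (Rn n)) (ℓ : ℝ) (g : Rn n → ℝ) (k ε : ℝ) (v : Rn (n + 1) → ℝ) :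
    Rn (n + 1) → ℝ :=
  trace (upper ω ℓ g k ε) (interface ω ℓ g k ε) v -
    trace (lower ω ℓ g k ε) (interface ω ℓ g k ε) v

/-- The convex set `K^ε_γ = {v ∈ W_0^ε | [v] ≥ 0 on Γ^ε}`. -/
def K {n : ℕ} (ω : Set (Rn n)) (ℓ : ℝ) (g : Rn n → ℝ) (k ε : ℝ) : Set (L2 ω ℓ) :=
  {v ∈ W0 ω ℓ g k ε | ∀ᵐ x ∂(surf (interface ω ℓ g k ε)), 0 ≤ jump ω ℓ g k ε v x}

/-- Weak solutions of the Signorini problem, with `A^ε(x) = A(x/ε)` and `h^ε(x') = h(x'/ε)`. -/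
structure IsWeakSolution {n : ℕ} (ω : Set (Rn n)) (ℓ : ℝ) (g : Rn n → ℝ) (k γ : ℝ)
    (A : Rn (n + 1) → Matrix (Fin (n + 1)) (Fin (n + 1)) ℝ) (h : Rn n → ℝ) (f : L2 ω ℓ)
    (ε : ℝ) (u : L2 ω ℓ) : Prop where
  mem : u ∈ K ω ℓ g k ε
  ineq : ∀ v ∈ K ω ℓ g k ε,
    ∫ x in cyl ω ℓ, f x * (v x - u x) ≤
      (∫ x in cyl ω ℓ \ interface ω ℓ g k ε,
        inner ℝ ((A (ε⁻¹ • x)).toEuclideanLin (grad ω ℓ g k ε u x))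
          (grad ω ℓ g k ε v x - grad ω ℓ g k ε u x)) +
      ε ^ γ * ∫ x, h (ε⁻¹ • horiz x) * jump ω ℓ g k ε u x *
        (jump ω ℓ g k ε v x - jump ω ℓ g k ε u x) ∂(surf (interface ω ℓ g k ε))

end

end Signorini

open Signorini

open Signorini

namespace Signorini

noncomputable section

/-! ### Coordinates -/

/-! At a fixed scale the problem is an elliptic variational inequality, solved by the
Lions–Stampacchia theorem. A function v of `W0` is encoded as the triple (v, ∇v, [v]) in a product
of three L² spaces. Such triples form a closed subspace `graphSpace`, and those with nonnegative
jump a closed convex cone `graphCone`, whose first components are exactly the elements of `K`. On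
triples the form is a bounded operator, A acting on the gradient and ε^γ h on the jump, and it does
not see v itself. Coercivity therefore needs the Poincaré inequality `HasGradJump.eLpNorm_le`.

The Poincaré constant is independent of ε: each vertical segment in the upper (lower) piece ends on
the top (bottom) of the cylinder, where the trace vanishes, and has length at most 2ℓ. The
fundamental theorem of calculus on these segments, Cauchy–Schwarz and Tonelli give a constant
depending on ℓ only. Testing with v = 0 then yields α‖∇u‖² + ε^γ h₀‖[u]‖² ≤ P‖f‖‖∇u‖, hence both
bounds (`exists_unique_obstacle`).

The same vertical segments give trace inequalities on the interface. Their constants may depend on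
ε, but they serve only qualitatively: interface traces exist, are unique, and pass to limits, which
makes `graphSpace` closed (`HasGradJump.of_tendsto`). All inequalities are proved for smooth
functions and transferred by density, since traces are defined through smooth approximation.

Periodicity enters through `ae_of_ae_unitCell`, which spreads the bounds on A and h from the unit
cell to almost every point. -/

/-- The point of `ℝ^(n+1)` with horizontal part `x'` and vertical coordinate `t`. -/
def join {n : ℕ} (x' : Rn n) (t : ℝ) : Rn (n + 1) :=
  WithLp.toLp 2 (Fin.snoc (α := fun _ => ℝ) (fun i => x' i) t)

@[simp] lemma horiz_join {n : ℕ} (x' : Rn n) (t : ℝ) : horiz (join x' t) = x' := by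
  ext i; simp [horiz, join]

@[simp] lemma vert_join {n : ℕ} (x' : Rn n) (t : ℝ) : vert (join x' t) = t := by
  simp [vert, join]

@[simp] lemma join_horiz_vert {n : ℕ} (x : Rn (n + 1)) : join (horiz x) (vert x) = x := by
  ext i
  refine Fin.lastCases ?_ (fun j => ?_) i <;> simp [horiz, join, vert]

lemma norm_sq_eq_horiz_vert {n : ℕ} (x : Rn (n + 1)) : ‖x‖ ^ 2 = ‖horiz x‖ ^ 2 + vert x ^ 2 := by
  simp [EuclideanSpace.norm_sq_eq, Fin.sum_univ_castSucc, horiz, vert]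

lemma horiz_sub {n : ℕ} (x y : Rn (n + 1)) : horiz (x - y) = horiz x - horiz y := by
  ext i; simp [horiz]

lemma vert_sub {n : ℕ} (x y : Rn (n + 1)) : vert (x - y) = vert x - vert y := by
  simp [vert]

lemma lipschitzWith_horiz {n : ℕ} : LipschitzWith 1 (horiz (n := n)) := by
  refine LipschitzWith.of_dist_le_mul fun x y => ?_
  rw [dist_eq_norm, dist_eq_norm, ← horiz_sub, NNReal.coe_one, one_mul]
  refine le_of_sq_le_sq ?_ (norm_nonneg _)
  nlinarith [norm_sq_eq_horiz_vert (x - y), sq_nonneg (vert (x - y))]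

@[fun_prop] lemma continuous_horiz {n : ℕ} : Continuous (horiz (n := n)) :=
  lipschitzWith_horiz.continuous

@[fun_prop] lemma continuous_vert {n : ℕ} : Continuous (vert (n := n)) := by
  unfold vert; fun_prop

lemma norm_join_sub_le {n : ℕ} (x' y' : Rn n) (s t : ℝ) :
    ‖join x' s - join y' t‖ ≤ ‖x' - y'‖ + |s - t| := by
  refine le_of_sq_le_sq ?_ (by positivity)
  have := norm_sq_eq_horiz_vert (join x' s - join y' t)
  simp only [horiz_sub, vert_sub, horiz_join, vert_join] at this
  nlinarith [sq_abs (s - t), norm_nonneg (x' - y'), abs_nonneg (s - t),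
    mul_nonneg (norm_nonneg (x' - y')) (abs_nonneg (s - t))]

lemma join_eq_add {n : ℕ} (x' : Rn n) (t : ℝ) :
    join x' t = join x' 0 + t • EuclideanSpace.single (Fin.last n) (1 : ℝ) := by
  ext i
  refine Fin.lastCases ?_ (fun j => ?_) i <;>
    simp [join, Fin.castSucc_ne_last]

lemma continuous_join {n : ℕ} : Continuous (fun p : Rn n × ℝ => join p.1 p.2) := by
  unfold join
  refine (PiLp.continuous_toLp 2 _).comp (continuous_pi fun i => ?_)
  refine Fin.lastCases ?_ (fun j => ?_) i
  · simpa using continuous_snd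
  · simp only [Fin.snoc_castSucc]; fun_prop

/-- Makes Tonelli's theorem available along vertical lines. The map is a composite of known
volume-preserving identifications. -/
lemma measurePreserving_join {n : ℕ} :
    MeasurePreserving (fun p : Rn n × ℝ => join p.1 p.2) (volume.prod volume) volume := by
  have h1 := (volume_preserving_piFinSuccAbove (fun _ : Fin (n + 1) => ℝ) (Fin.last n)).symm
  have h2 := EuclideanSpace.volume_preserving_symm_measurableEquiv_toLp (Fin n)
  have h3 := (EuclideanSpace.volume_preserving_symm_measurableEquiv_toLp (Fin (n + 1))).symm
  have h4 := h3.comp (h1.comp (((MeasurePreserving.id (volume : Measure ℝ)).prod h2).comp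
    (Measure.measurePreserving_swap (μ := (volume : Measure (Rn n))) (ν := (volume : Measure ℝ)))))
  have key : (fun p : Rn n × ℝ => join p.1 p.2) =
      (MeasurableEquiv.toLp 2 (Fin (n + 1) → ℝ)).symm.symm ∘
      (MeasurableEquiv.piFinSuccAbove (fun _ => ℝ) (Fin.last n)).symm ∘
        Prod.map id (MeasurableEquiv.toLp 2 (Fin n → ℝ)).symm ∘ Prod.swap := by
    funext p
    ext i
    change Fin.snoc (α := fun _ => ℝ) (fun j => p.1 j) p.2 i =
      Fin.insertNth (α := fun _ => ℝ) (Fin.last n) p.2 (fun j => p.1 j) i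
    rw [Fin.insertNth_last']
  rw [key]
  exact h4

/-! ### The surface measure on graphs -/

/-- Vertical projection is 1-Lipschitz, so it does not increase Hausdorff measure. `S` need only
contain the graph, which lets it be the whole outer boundary of one component. -/
lemma restrict_map_graph_le_surf {n : ℕ} {ω : Set (Rn n)} {c : Rn n → ℝ} (hc : Measurable c)
    {S : Set (Rn (n + 1))} (hS : ∀ x' ∈ ω, join x' (c x') ∈ S) :
    (volume.restrict ω).map (fun x' => join x' (c x')) ≤ surf S := by
  refine Measure.le_iff.2 fun E hE => ?_
  have hm : Measurable fun x' => join x' (c x') :=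
    continuous_join.measurable.comp (measurable_id.prodMk hc)
  rw [Measure.map_apply hm hE, Measure.restrict_apply (hm hE), surf, Measure.restrict_apply hE,
    ← EuclideanSpace.euclideanHausdorffMeasure_eq_volume]
  refine (measure_mono (t := horiz '' (E ∩ S)) ?_).trans ?_
  · rintro x' ⟨h1, h2⟩
    exact ⟨_, ⟨h1, hS x' h2⟩, by simp⟩
  · simp only [Measure.euclideanHausdorffMeasure_def, Measure.smul_apply]
    gcongr
    simpa using lipschitzWith_horiz.hausdorffMeasure_image_le (d := n) (by positivity) (E ∩ S)

/-- The converse comparison: the graph map is (1 + L)-Lipschitz and so expands n-dimensional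
Hausdorff measure by at most (1 + L)^n. Here `S` must lie inside the graph. -/
lemma exists_surf_graph_le {n : ℕ} {ω : Set (Rn n)} {c : Rn n → ℝ} {L : NNReal}
    (hc : LipschitzWith L c) {S : Set (Rn (n + 1))}
    (hS : ∀ x ∈ S, horiz x ∈ ω ∧ vert x = c (horiz x)) :
    ∃ C : NNReal, surf S ≤ C • (volume.restrict ω).map (fun x' => join x' (c x')) := by
  have hlip : LipschitzWith (1 + L) (fun x' => join x' (c x')) := by
    refine LipschitzWith.of_dist_le_mul fun x y => ?_
    rw [dist_eq_norm, dist_eq_norm]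
    refine (norm_join_sub_le _ _ _ _).trans ?_
    have := hc.dist_le_mul x y
    rw [Real.dist_eq, dist_eq_norm] at this
    push_cast
    linarith
  refine ⟨(1 + L) ^ n, Measure.le_iff.2 fun E hE => ?_⟩
  have hm := hlip.continuous.measurable
  rw [Measure.smul_apply, Measure.map_apply hm hE, Measure.restrict_apply (hm hE), surf,
    Measure.restrict_apply hE, ← EuclideanSpace.euclideanHausdorffMeasure_eq_volume]
  refine (measure_mono (t := (fun x' => join x' (c x')) ''
    ((fun x' => join x' (c x')) ⁻¹' E ∩ ω)) ?_).trans ?_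
  · rintro x ⟨h1, h2⟩
    obtain ⟨h3, h4⟩ := hS x h2
    have : join (horiz x) (c (horiz x)) = x := by rw [← h4]; simp
    exact ⟨horiz x, ⟨by simpa [this] using h1, h3⟩, this⟩
  · simp only [Measure.euclideanHausdorffMeasure_def, Measure.smul_apply]
    rw [smul_comm]
    gcongr
    refine (hlip.hausdorffMeasure_image_le (d := n) (by positivity) _).trans ?_
    simp [ENNReal.smul_def]

/-! ### Integration over slabs between two graphs -/

/-- The set of points over `ω` lying strictly between the graphs of `a` and `b`. -/
def slab {n : ℕ} (ω : Set (Rn n)) (a b : Rn n → ℝ) : Set (Rn (n + 1)) :=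
  {x | horiz x ∈ ω ∧ vert x ∈ Ioo (a (horiz x)) (b (horiz x))}

lemma isOpen_slab {n : ℕ} {ω : Set (Rn n)} {a b : Rn n → ℝ} (hω : IsOpen ω)
    (ha : Continuous a) (hb : Continuous b) : IsOpen (slab ω a b) :=
  (hω.preimage continuous_horiz).inter
    ((isOpen_lt (ha.comp continuous_horiz) continuous_vert).inter
      (isOpen_lt continuous_vert (hb.comp continuous_horiz)))

lemma setLIntegral_slab {n : ℕ} {ω : Set (Rn n)} {a b : Rn n → ℝ} (hω : IsOpen ω)
    (ha : Continuous a) (hb : Continuous b) {F : Rn (n + 1) → ℝ≥0∞} (hF : Measurable F) :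
    ∫⁻ x in slab ω a b, F x = ∫⁻ x' in ω, ∫⁻ t in Ioo (a x') (b x'), F (join x' t) := by
  have hm := (isOpen_slab hω ha hb).measurableSet
  rw [← lintegral_indicator hm, ← measurePreserving_join.lintegral_comp (hF.indicator hm),
    lintegral_prod (fun p : Rn n × ℝ => (slab ω a b).indicator F (join p.1 p.2))
      ((hF.indicator hm).comp measurePreserving_join.measurable).aemeasurable,
    ← lintegral_indicator hω.measurableSet]
  refine lintegral_congr fun x' => ?_
  by_cases hx : x' ∈ ω
  · rw [indicator_of_mem hx, ← lintegral_indicator measurableSet_Ioo]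
    refine lintegral_congr fun t => ?_
    simp only [indicator, slab, mem_ofPred_eq, horiz_join, vert_join, hx, true_and]
  · rw [indicator_of_notMem hx]
    simp [indicator, slab, hx]

lemma ennreal_add_sq_le (x y : ℝ≥0∞) : (x + y) ^ 2 ≤ 2 * x ^ 2 + 2 * y ^ 2 := by
  have := ENNReal.rpow_add_le_mul_rpow_add_rpow x y (p := 2) (by norm_num)
  norm_num at this
  calc (x + y) ^ 2 ≤ 2 * (x ^ 2 + y ^ 2) := by exact_mod_cast this
    _ = _ := by ring

lemma sq_lintegral_le {α : Type*} [MeasurableSpace α] (μ : Measure α) {f : α → ℝ≥0∞}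
    (hf : AEMeasurable f μ) : (∫⁻ x, f x ∂μ) ^ 2 ≤ μ univ * ∫⁻ x, f x ^ 2 ∂μ := by
  have h := ENNReal.lintegral_mul_le_Lp_mul_Lq μ Real.HolderConjugate.two_two hf
    (aemeasurable_const (b := (1 : ℝ≥0∞)))
  simp only [Pi.mul_apply, mul_one, ENNReal.one_rpow, lintegral_one] at h
  calc (∫⁻ x, f x ∂μ) ^ 2
      ≤ ((∫⁻ x, f x ^ (2 : ℝ) ∂μ) ^ (1 / 2 : ℝ) * μ univ ^ (1 / 2 : ℝ)) ^ 2 := by gcongr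
    _ = _ := by
      rw [mul_pow, ← ENNReal.rpow_natCast, ← ENNReal.rpow_natCast, ← ENNReal.rpow_mul,
        ← ENNReal.rpow_mul]
      norm_num [mul_comm]

/-- The fundamental theorem of calculus and Cauchy–Schwarz on an interval of length at most M. Both
the trace and the Poincaré inequality are integrals of this bound: the former averages over t, the
latter integrates over s with t at the boundary point. -/
lemma enorm_sq_le_of_mem_Icc {p : ℝ → ℝ} (hp : ContDiff ℝ 1 p) {a b s t M : ℝ}
    (hs : s ∈ Icc a b) (ht : t ∈ Icc a b) (hM : b - a ≤ M) :
    ‖p s‖ₑ ^ 2 ≤ 2 * ‖p t‖ₑ ^ 2 + 2 * ENNReal.ofReal M * ∫⁻ r in Ioo a b, ‖deriv p r‖ₑ ^ 2 := by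
  have hc : Continuous (deriv p) := hp.continuous_deriv le_rfl
  have h1 : ‖p s - p t‖ₑ ≤ ∫⁻ r in Ioo a b, ‖deriv p r‖ₑ := by
    rw [← intervalIntegral.integral_deriv_eq_sub
      (fun x _ => (hp.differentiable one_ne_zero).differentiableAt)
      (hc.intervalIntegrable _ _), ← ofReal_norm, intervalIntegral.norm_intervalIntegral_eq,
      ofReal_norm]
    refine (enorm_integral_le_lintegral_enorm _).trans ?_
    rw [restrict_Ioo_eq_restrict_Ioc]
    exact lintegral_mono_set (Set.Ioc_subset_Ioc (le_min ht.1 hs.1) (max_le ht.2 hs.2))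
  have h2 : ‖p s - p t‖ₑ ^ 2 ≤ ENNReal.ofReal M * ∫⁻ r in Ioo a b, ‖deriv p r‖ₑ ^ 2 := by
    refine (pow_le_pow_left' h1 2).trans ((sq_lintegral_le _ hc.enorm.aemeasurable).trans ?_)
    gcongr
    simpa using ENNReal.ofReal_le_ofReal hM
  calc ‖p s‖ₑ ^ 2 = ‖p t + (p s - p t)‖ₑ ^ 2 := by rw [add_sub_cancel]
    _ ≤ (‖p t‖ₑ + ‖p s - p t‖ₑ) ^ 2 := by gcongr; exact enorm_add_le _ _
    _ ≤ 2 * ‖p t‖ₑ ^ 2 + 2 * ‖p s - p t‖ₑ ^ 2 := ennreal_add_sq_le _ _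
    _ ≤ _ := by rw [mul_assoc 2 (ENNReal.ofReal M)]; gcongr

lemma enorm_deriv_vertical_le {n : ℕ} {φ : Rn (n + 1) → ℝ} (hφ : ContDiff ℝ (⊤ : ℕ∞) φ)
    (x' : Rn n) (t : ℝ) : ‖deriv (fun r => φ (join x' r)) t‖ₑ ≤ ‖∇ φ (join x' t)‖ₑ := by
  have h1 : HasDerivAt (fun r => join x' r) (EuclideanSpace.single (Fin.last n) (1 : ℝ)) t := by
    rw [show (fun r => join x' r) = fun r => join x' 0 + r • EuclideanSpace.single (Fin.last n)
      (1 : ℝ) from funext (join_eq_add x')]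
    simpa using ((hasDerivAt_id t).smul_const (EuclideanSpace.single (Fin.last n) (1 : ℝ))).const_add
      (join x' 0)
  have hd := (hφ.differentiable (by simp)).differentiableAt (x := join x' t)
  have h2 := hd.hasFDerivAt.comp_hasDerivAt t h1
  rw [show (fun r => φ (join x' r)) = φ ∘ join x' from rfl, h2.deriv,
    ← inner_gradient_left, ← ofReal_norm, ← ofReal_norm]
  refine ENNReal.ofReal_le_ofReal ((norm_inner_le_norm _ _).trans ?_)
  simp

lemma enorm_sq_le_of_vertical {n : ℕ} {φ : Rn (n + 1) → ℝ} (hφ : ContDiff ℝ (⊤ : ℕ∞) φ)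
    (x' : Rn n) {a b s t M : ℝ} (hs : s ∈ Icc a b) (ht : t ∈ Icc a b) (hM : b - a ≤ M) :
    ‖φ (join x' s)‖ₑ ^ 2 ≤ 2 * ‖φ (join x' t)‖ₑ ^ 2 +
      2 * ENNReal.ofReal M * ∫⁻ r in Ioo a b, ‖∇ φ (join x' r)‖ₑ ^ 2 := by
  have hj : ContDiff ℝ 1 (fun r => join x' r) := by
    rw [show (fun r => join x' r) = fun r => join x' 0 + r • EuclideanSpace.single (Fin.last n)
      (1 : ℝ) from funext (join_eq_add x')]
    fun_prop
  refine (enorm_sq_le_of_mem_Icc (p := fun r => φ (join x' r))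
    ((hφ.of_le (by exact_mod_cast le_top)).comp hj) hs ht hM).trans ?_
  gcongr
  exact enorm_deriv_vertical_le hφ x' _

lemma continuous_gradient {d : ℕ} {φ : Rn d → ℝ} (hφ : ContDiff ℝ (⊤ : ℕ∞) φ) :
    Continuous (∇ φ) :=
  (InnerProductSpace.toDual ℝ (Rn d)).symm.continuous.comp (hφ.continuous_fderiv (by simp))

/-- Trace inequality on a graph for smooth functions. -/
lemma lintegral_graph_le {n : ℕ} {ω : Set (Rn n)} {a b c : Rn n → ℝ} {δ M : ℝ} (hω : IsOpen ω)
    (ha : Continuous a) (hb : Continuous b)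
    (hc : ∀ x' ∈ ω, c x' ∈ Icc (a x') (b x')) (hδ : ∀ x' ∈ ω, δ ≤ b x' - a x')
    (hM : ∀ x' ∈ ω, b x' - a x' ≤ M) {φ : Rn (n + 1) → ℝ} (hφ : ContDiff ℝ (⊤ : ℕ∞) φ) :
    ENNReal.ofReal δ * ∫⁻ x' in ω, ‖φ (join x' (c x'))‖ₑ ^ 2 ≤
      2 * (∫⁻ x in slab ω a b, ‖φ x‖ₑ ^ 2) +
        2 * ENNReal.ofReal M ^ 2 * ∫⁻ x in slab ω a b, ‖∇ φ x‖ₑ ^ 2 := by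
  have hm1 : Measurable fun x => ‖φ x‖ₑ ^ 2 := (hφ.continuous.enorm.measurable).pow_const 2
  have hm2 : Measurable fun x => ‖∇ φ x‖ₑ ^ 2 :=
    ((continuous_gradient hφ).enorm.measurable).pow_const 2
  have hjm : ∀ x' : Rn n, Measurable fun t => join x' t := fun x' =>
    continuous_join.measurable.comp (measurable_const.prodMk measurable_id)
  rw [← lintegral_const_mul _ hm1, ← lintegral_const_mul _ hm2,
    ← lintegral_add_left (hm1.const_mul _), setLIntegral_slab hω ha hb (F := fun x =>
      2 * ‖φ x‖ₑ ^ 2 + 2 * ENNReal.ofReal M ^ 2 * ‖∇ φ x‖ₑ ^ 2)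
      ((hm1.const_mul _).add (hm2.const_mul _)), ← lintegral_const_mul' _ _ ENNReal.ofReal_ne_top]
  refine setLIntegral_mono_ae' hω.measurableSet (.of_forall fun x' hx => ?_)
  have hj1 : Measurable fun t => ‖φ (join x' t)‖ₑ ^ 2 := hm1.comp (hjm x')
  have hj2 : Measurable fun t => ‖∇ φ (join x' t)‖ₑ ^ 2 := hm2.comp (hjm x')
  rw [lintegral_add_left (hj1.const_mul 2), lintegral_const_mul _ hj1, lintegral_const_mul _ hj2]
  set G := ∫⁻ r in Ioo (a x') (b x'), ‖∇ φ (join x' r)‖ₑ ^ 2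
  have hvol : volume (Ioo (a x') (b x')) ≤ ENNReal.ofReal M := by
    simpa using ENNReal.ofReal_le_ofReal (hM x' hx)
  -- The value on the graph is averaged over the whole vertical segment, whose length is at least δ.
  calc ENNReal.ofReal δ * ‖φ (join x' (c x'))‖ₑ ^ 2
      ≤ volume (Ioo (a x') (b x')) * ‖φ (join x' (c x'))‖ₑ ^ 2 := by
        gcongr; simpa using ENNReal.ofReal_le_ofReal (hδ x' hx)
    _ = ∫⁻ t in Ioo (a x') (b x'), ‖φ (join x' (c x'))‖ₑ ^ 2 := by simp [mul_comm]
    _ ≤ ∫⁻ t in Ioo (a x') (b x'), (2 * ‖φ (join x' t)‖ₑ ^ 2 + 2 * ENNReal.ofReal M * G) :=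
        setLIntegral_mono_ae' measurableSet_Ioo (.of_forall fun t ht =>
          enorm_sq_le_of_vertical hφ x' (hc x' hx) (Ioo_subset_Icc_self ht) (hM x' hx))
    _ = 2 * (∫⁻ t in Ioo (a x') (b x'), ‖φ (join x' t)‖ₑ ^ 2) +
          2 * ENNReal.ofReal M * G * volume (Ioo (a x') (b x')) := by
        rw [lintegral_add_right _ measurable_const, lintegral_const_mul _ hj1]
        simp
    _ ≤ 2 * (∫⁻ t in Ioo (a x') (b x'), ‖φ (join x' t)‖ₑ ^ 2) +
          2 * ENNReal.ofReal M * G * ENNReal.ofReal M := by gcongr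
    _ = _ := by ring

/-- Poincaré inequality on a slab for smooth functions. -/
lemma lintegral_slab_le {n : ℕ} {ω : Set (Rn n)} {a b c : Rn n → ℝ} {M : ℝ} (hω : IsOpen ω)
    (ha : Continuous a) (hb : Continuous b) (hcm : Measurable c)
    (hc : ∀ x' ∈ ω, c x' ∈ Icc (a x') (b x'))
    (hM : ∀ x' ∈ ω, b x' - a x' ≤ M) {φ : Rn (n + 1) → ℝ} (hφ : ContDiff ℝ (⊤ : ℕ∞) φ) :
    ∫⁻ x in slab ω a b, ‖φ x‖ₑ ^ 2 ≤
      2 * ENNReal.ofReal M * (∫⁻ x' in ω, ‖φ (join x' (c x'))‖ₑ ^ 2) +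
        2 * ENNReal.ofReal M ^ 2 * ∫⁻ x in slab ω a b, ‖∇ φ x‖ₑ ^ 2 := by
  have hm1 : Measurable fun x => ‖φ x‖ₑ ^ 2 := (hφ.continuous.enorm.measurable).pow_const 2
  have hm2 : Measurable fun x => ‖∇ φ x‖ₑ ^ 2 :=
    ((continuous_gradient hφ).enorm.measurable).pow_const 2
  have hm3 : Measurable fun x' => ‖φ (join x' (c x'))‖ₑ ^ 2 :=
    hm1.comp (continuous_join.measurable.comp (measurable_id.prodMk hcm))
  rw [setLIntegral_slab hω ha hb hm1, setLIntegral_slab hω ha hb hm2, ← lintegral_const_mul _ hm3,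
    ← lintegral_const_mul' _ _ (by finiteness), ← lintegral_add_left (hm3.const_mul _)]
  refine setLIntegral_mono_ae' hω.measurableSet (.of_forall fun x' hx => ?_)
  set G := ∫⁻ r in Ioo (a x') (b x'), ‖∇ φ (join x' r)‖ₑ ^ 2
  have hvol : volume (Ioo (a x') (b x')) ≤ ENNReal.ofReal M := by
    simpa using ENNReal.ofReal_le_ofReal (hM x' hx)
  calc ∫⁻ t in Ioo (a x') (b x'), ‖φ (join x' t)‖ₑ ^ 2
      ≤ ∫⁻ t in Ioo (a x') (b x'), (2 * ‖φ (join x' (c x'))‖ₑ ^ 2 + 2 * ENNReal.ofReal M * G) :=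
        setLIntegral_mono_ae' measurableSet_Ioo (.of_forall fun t ht =>
          enorm_sq_le_of_vertical hφ x' (Ioo_subset_Icc_self ht) (hc x' hx) (hM x' hx))
    _ = (2 * ‖φ (join x' (c x'))‖ₑ ^ 2 + 2 * ENNReal.ofReal M * G) *
          volume (Ioo (a x') (b x')) := by simp
    _ ≤ (2 * ‖φ (join x' (c x'))‖ₑ ^ 2 + 2 * ENNReal.ofReal M * G) * ENNReal.ofReal M := by gcongr
    _ = _ := by ring

/-- Each vertical slice of a graph is a single point, so Fubini applies. -/
lemma volume_graph_eq_zero {n : ℕ} {c : Rn n → ℝ} (hc : Continuous c) {S : Set (Rn (n + 1))}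
    (hS : ∀ x ∈ S, vert x = c (horiz x)) : volume S = 0 := by
  refine measure_mono_null (t := {x | vert x = c (horiz x)}) hS ?_
  have hm : MeasurableSet {x : Rn (n + 1) | vert x = c (horiz x)} :=
    (isClosed_eq continuous_vert (hc.comp continuous_horiz)).measurableSet
  rw [← measurePreserving_join.measure_preimage hm.nullMeasurableSet,
    Measure.measure_prod_null (measurePreserving_join.measurable hm)]
  refine .of_forall fun x' => ?_
  simp

/-! ### Weak gradients -/

section WeakGrad

variable {d : ℕ} {Ω : Set (Rn d)} {v w : Rn d → ℝ} {F G : Rn d → Rn d}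

lemma memLp_gradient_of_hasCompactSupport {φ : Rn d → ℝ} (hφ : ContDiff ℝ (⊤ : ℕ∞) φ)
    (hc : HasCompactSupport φ) (μ : Measure (Rn d)) [IsFiniteMeasureOnCompacts μ] :
    MemLp (∇ φ) 2 μ := by
  refine (continuous_gradient hφ).memLp_of_hasCompactSupport ?_
  exact (hc.fderiv ℝ).comp_left (g := (InnerProductSpace.toDual ℝ (Rn d)).symm) (map_zero _)

lemma eLpNorm_one_smul_le {α E : Type*} [MeasurableSpace α] [NormedAddCommGroup E]
    [NormedSpace ℝ E] {μ : Measure α} {f : α → ℝ} {g : α → E}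
    (hf : AEStronglyMeasurable f μ) (hg : AEStronglyMeasurable g μ) :
    eLpNorm (f • g) 1 μ ≤ eLpNorm f 2 μ * eLpNorm g 2 μ :=
  eLpNorm_smul_le_mul_eLpNorm hg hf

lemma integrable_smul_of_memLp_two {α E : Type*} [MeasurableSpace α] [NormedAddCommGroup E]
    [NormedSpace ℝ E] {μ : Measure α} {f : α → ℝ} {g : α → E} (hf : MemLp f 2 μ)
    (hg : MemLp g 2 μ) : Integrable (fun x => f x • g x) μ :=
  memLp_one_iff_integrable.1 (hg.smul hf)

/-- The fundamental lemma of the calculus of variations. It makes the arbitrary choice in `weakGrad`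
harmless. -/
lemma IsWeakGrad.ae_eq (hΩ : IsOpen Ω) (hF : IsWeakGrad Ω v F) (hG : IsWeakGrad Ω w G)
    (hvw : v =ᵐ[volume.restrict Ω] w) : F =ᵐ[volume.restrict Ω] G := by
  have hloc : LocallyIntegrable (F - G) (volume.restrict Ω) :=
    (hF.memLp_grad.sub hG.memLp_grad).locallyIntegrable (by norm_num)
  have key := hΩ.ae_eq_zero_of_integral_contDiff_smul_eq_zero (hloc.locallyIntegrableOn Ω)
    fun φ h1 h2 h3 => by
      have hφ : MemLp φ 2 (volume.restrict Ω) := h1.continuous.memLp_of_hasCompactSupport h2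
      have e1 := hF.integral_eq φ h1 h2 h3
      have e2 := hG.integral_eq φ h1 h2 h3
      have e3 : ∫ x in Ω, v x • ∇ φ x = ∫ x in Ω, w x • ∇ φ x :=
        integral_congr_ae (hvw.mono fun x hx => by simp only [hx])
      simp only [Pi.sub_apply, smul_sub]
      rw [integral_sub (integrable_smul_of_memLp_two hφ hF.memLp_grad)
        (integrable_smul_of_memLp_two hφ hG.memLp_grad), sub_eq_zero, ← neg_inj, ← e1, ← e2, e3]
  filter_upwards [key, ae_restrict_mem hΩ.measurableSet] with x hx hxΩ
  exact sub_eq_zero.1 (hx hxΩ)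

lemma IsWeakGrad.congr (hF : IsWeakGrad Ω v F) (hvw : v =ᵐ[volume.restrict Ω] w)
    (hFG : F =ᵐ[volume.restrict Ω] G) : IsWeakGrad Ω w G where
  memLp := hF.memLp.ae_eq hvw
  memLp_grad := hF.memLp_grad.ae_eq hFG
  integral_eq φ h1 h2 h3 := by
    rw [← integral_congr_ae (hvw.mono fun x hx => by simp only [hx] :
        (fun x => v x • ∇ φ x) =ᵐ[volume.restrict Ω] fun x => w x • ∇ φ x),
      ← integral_congr_ae (hFG.mono fun x hx => by simp only [hx] :
        (fun x => φ x • F x) =ᵐ[volume.restrict Ω] fun x => φ x • G x)]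
    exact hF.integral_eq φ h1 h2 h3

lemma IsWeakGrad.zero : IsWeakGrad Ω (0 : Rn d → ℝ) 0 where
  memLp := MemLp.zero
  memLp_grad := MemLp.zero
  integral_eq φ _ _ _ := by simp

lemma IsWeakGrad.add_smul (hF : IsWeakGrad Ω v F) (hG : IsWeakGrad Ω w G) (c : ℝ) :
    IsWeakGrad Ω (v + c • w) (F + c • G) where
  memLp := hF.memLp.add (hG.memLp.const_smul c)
  memLp_grad := hF.memLp_grad.add (hG.memLp_grad.const_smul c)
  integral_eq φ h1 h2 h3 := by
    have hφ : MemLp φ 2 (volume.restrict Ω) := h1.continuous.memLp_of_hasCompactSupport h2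
    have hφ' := memLp_gradient_of_hasCompactSupport h1 h2 (volume.restrict Ω)
    have e1 : ∀ x, (v + c • w) x • ∇ φ x = v x • ∇ φ x + c • (w x • ∇ φ x) := fun x => by
      simp [_root_.add_smul, smul_smul]
    have e2 : ∀ x, φ x • (F + c • G) x = φ x • F x + c • (φ x • G x) := fun x => by
      simp only [Pi.add_apply, Pi.smul_apply, smul_add]
      rw [smul_comm]
    have i1 : Integrable (fun x => c • (w x • ∇ φ x)) (volume.restrict Ω) :=
      (integrable_smul_of_memLp_two hG.memLp hφ').smul c
    have i2 : Integrable (fun x => c • (φ x • G x)) (volume.restrict Ω) :=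
      (integrable_smul_of_memLp_two hφ hG.memLp_grad).smul c
    simp only [e1, e2]
    rw [integral_add (integrable_smul_of_memLp_two hF.memLp hφ') i1,
      integral_add (integrable_smul_of_memLp_two hφ hF.memLp_grad) i2, integral_smul, integral_smul,
      hF.integral_eq φ h1 h2 h3, hG.integral_eq φ h1 h2 h3, smul_neg, neg_add]

/-- The weak gradient is a closed operator: against a fixed test function, both sides of the
defining identity are continuous in L² by Hölder. -/
lemma IsWeakGrad.of_tendsto {vs : ℕ → Rn d → ℝ} {Fs : ℕ → Rn d → Rn d}
    (h : ∀ j, IsWeakGrad Ω (vs j) (Fs j)) (hv : MemLp v 2 (volume.restrict Ω))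
    (hF : MemLp F 2 (volume.restrict Ω))
    (hvs : Tendsto (fun j => eLpNorm (vs j - v) 2 (volume.restrict Ω)) atTop (𝓝 0))
    (hFs : Tendsto (fun j => eLpNorm (Fs j - F) 2 (volume.restrict Ω)) atTop (𝓝 0)) :
    IsWeakGrad Ω v F where
  memLp := hv
  memLp_grad := hF
  integral_eq φ h1 h2 h3 := by
    have hφ : MemLp φ 2 (volume.restrict Ω) := h1.continuous.memLp_of_hasCompactSupport h2
    have hφ' := memLp_gradient_of_hasCompactSupport h1 h2 (volume.restrict Ω)
    have t1 : Tendsto (fun j => ∫ x in Ω, vs j x • ∇ φ x) atTop (𝓝 (∫ x in Ω, v x • ∇ φ x)) := by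
      refine tendsto_integral_of_L1' _ (integrable_smul_of_memLp_two hv hφ').aestronglyMeasurable
        (.of_forall fun j => integrable_smul_of_memLp_two (h j).memLp hφ') ?_
      refine tendsto_of_tendsto_of_tendsto_of_le_of_le tendsto_const_nhds
        (by simpa using ENNReal.Tendsto.mul_const hvs (.inr hφ'.2.ne)) (fun _ => zero_le) fun j => ?_
      refine le_trans (le_of_eq ?_) (eLpNorm_one_smul_le ((h j).memLp.sub hv).1 hφ'.1)
      congr 1
      ext x; simp [sub_smul]
    have t2 : Tendsto (fun j => ∫ x in Ω, φ x • Fs j x) atTop (𝓝 (∫ x in Ω, φ x • F x)) := by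
      refine tendsto_integral_of_L1' _ (integrable_smul_of_memLp_two hφ hF).aestronglyMeasurable
        (.of_forall fun j => integrable_smul_of_memLp_two hφ (h j).memLp_grad) ?_
      refine tendsto_of_tendsto_of_tendsto_of_le_of_le tendsto_const_nhds
        (by simpa using ENNReal.Tendsto.const_mul hFs (.inr hφ.2.ne)) (fun _ => zero_le) fun j => ?_
      refine le_trans (le_of_eq ?_) (eLpNorm_one_smul_le hφ.1 ((h j).memLp_grad.sub hF).1)
      congr 1
      ext x; simp [smul_sub]
    refine tendsto_nhds_unique t1 ?_
    simp only [fun j => (h j).integral_eq φ h1 h2 h3]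
    exact t2.neg

lemma MemH1.isWeakGrad (h : MemH1 Ω v) : IsWeakGrad Ω v (weakGrad Ω v) := by
  rw [weakGrad, dif_pos h]; exact h.choose_spec

end WeakGrad

/-! ### Approximation by functions smooth up to the boundary -/

lemma gradient_add_smul {d : ℕ} {φ ψ : Rn d → ℝ} (hφ : ContDiff ℝ (⊤ : ℕ∞) φ)
    (hψ : ContDiff ℝ (⊤ : ℕ∞) ψ) (c : ℝ) : ∇ (φ + c • ψ) = ∇ φ + c • ∇ ψ := by
  funext x
  have h1 := (hφ.differentiable (by simp)).differentiableAt (x := x)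
  have h2 := (hψ.differentiable (by simp)).differentiableAt (x := x)
  simp only [gradient, Pi.add_apply, Pi.smul_apply]
  rw [fderiv_add h1 (h2.const_smul c), fderiv_const_smul h2 c, map_add, map_smul]

lemma tendsto_eLpNorm_add_smul {α E : Type*} [MeasurableSpace α] [NormedAddCommGroup E]
    [NormedSpace ℝ E] {μ : Measure α} {f g : ℕ → α → E} {f₀ g₀ : α → E}
    (hf : ∀ m, AEStronglyMeasurable (f m) μ) (hg : ∀ m, AEStronglyMeasurable (g m) μ)
    (hf₀ : AEStronglyMeasurable f₀ μ) (hg₀ : AEStronglyMeasurable g₀ μ)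
    (tf : Tendsto (fun m => eLpNorm (f m - f₀) 2 μ) atTop (𝓝 0))
    (tg : Tendsto (fun m => eLpNorm (g m - g₀) 2 μ) atTop (𝓝 0)) (c : ℝ) :
    Tendsto (fun m => eLpNorm (f m + c • g m - (f₀ + c • g₀)) 2 μ) atTop (𝓝 0) := by
  refine tendsto_of_tendsto_of_tendsto_of_le_of_le tendsto_const_nhds (h := fun m =>
    eLpNorm (f m - f₀) 2 μ + ‖c‖ₑ * eLpNorm (g m - g₀) 2 μ)
    (by simpa using tf.add (ENNReal.Tendsto.const_mul tg (.inr enorm_ne_top)))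
    (fun _ => zero_le) fun m => ?_
  have : f m + c • g m - (f₀ + c • g₀) = (f m - f₀) + c • (g m - g₀) := by
    rw [smul_sub]; abel
  simp only [this]
  refine (eLpNorm_add_le ((hf m).sub hf₀) (((hg m).sub hg₀).const_smul c) (by norm_num)).trans ?_
  rw [eLpNorm_const_smul]

/-- `v ∈ L²(Ω)`, `F ∈ L²(Ω; ℝ^N)` and `T ∈ L²(S)` are simultaneous limits of smooth functions, of
their gradients, and of their restrictions to `S`. -/
structure SmoothApprox {n : ℕ} (Ω S : Set (Rn (n + 1))) (v : Rn (n + 1) → ℝ)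
    (F : Rn (n + 1) → Rn (n + 1)) (T : Rn (n + 1) → ℝ) : Prop where
  memLp : MemLp v 2 (volume.restrict Ω)
  memLp_grad : MemLp F 2 (volume.restrict Ω)
  memLp_trace : MemLp T 2 (surf S)
  exists_approx : ∃ φ : ℕ → Rn (n + 1) → ℝ, (∀ m, ContDiff ℝ (⊤ : ℕ∞) (φ m)) ∧
    Tendsto (fun m => eLpNorm (φ m - v) 2 (volume.restrict Ω)) atTop (𝓝 0) ∧
    Tendsto (fun m => eLpNorm (∇ (φ m) - F) 2 (volume.restrict Ω)) atTop (𝓝 0) ∧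
    Tendsto (fun m => eLpNorm (φ m - T) 2 (surf S)) atTop (𝓝 0)

section SmoothApprox

variable {n : ℕ} {Ω S : Set (Rn (n + 1))} {v w : Rn (n + 1) → ℝ}
  {F G : Rn (n + 1) → Rn (n + 1)} {T U : Rn (n + 1) → ℝ}

/-- Replaces the chosen representative `weakGrad` by a free parameter, so that linearity and limits
can be handled without reference to a choice; `SmoothApprox.isTrace` goes back. -/
lemma IsTrace.smoothApprox (h : IsTrace Ω S v T) : SmoothApprox Ω S v (weakGrad Ω v) T where
  memLp := h.memH1.isWeakGrad.memLp
  memLp_grad := h.memH1.isWeakGrad.memLp_grad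
  memLp_trace := h.memLp
  exists_approx := h.exists_approx

lemma SmoothApprox.congr (h : SmoothApprox Ω S v F T) (hv : v =ᵐ[volume.restrict Ω] w)
    (hF : F =ᵐ[volume.restrict Ω] G) (hT : T =ᵐ[surf S] U) : SmoothApprox Ω S w G U where
  memLp := h.memLp.ae_eq hv
  memLp_grad := h.memLp_grad.ae_eq hF
  memLp_trace := h.memLp_trace.ae_eq hT
  exists_approx := by
    obtain ⟨φ, h0, h1, h2, h3⟩ := h.exists_approx
    refine ⟨φ, h0, ?_, ?_, ?_⟩
    · exact h1.congr fun m => eLpNorm_congr_ae (EventuallyEq.rfl.sub hv)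
    · exact h2.congr fun m => eLpNorm_congr_ae (EventuallyEq.rfl.sub hF)
    · exact h3.congr fun m => eLpNorm_congr_ae (EventuallyEq.rfl.sub hT)

lemma SmoothApprox.isTrace (hΩ : IsOpen Ω) (hF : IsWeakGrad Ω v F)
    (h : SmoothApprox Ω S v F T) : IsTrace Ω S v T where
  memH1 := ⟨F, hF⟩
  memLp := h.memLp_trace
  exists_approx := (h.congr .rfl (hF.ae_eq hΩ (MemH1.isWeakGrad ⟨F, hF⟩) .rfl) .rfl).exists_approx

lemma SmoothApprox.zero : SmoothApprox Ω S 0 0 0 where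
  memLp := MemLp.zero
  memLp_grad := MemLp.zero
  memLp_trace := MemLp.zero
  exists_approx := by
    have h0 : ∇ (0 : Rn (n + 1) → ℝ) = 0 := by
      funext x; exact gradient_fun_const x (0 : ℝ)
    refine ⟨0, fun _ => contDiff_const, ?_, ?_, ?_⟩ <;> simp [h0]

lemma SmoothApprox.add_smul (hv : SmoothApprox Ω S v F T) (hw : SmoothApprox Ω S w G U) (c : ℝ) :
    SmoothApprox Ω S (v + c • w) (F + c • G) (T + c • U) where
  memLp := hv.memLp.add (hw.memLp.const_smul c)
  memLp_grad := hv.memLp_grad.add (hw.memLp_grad.const_smul c)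
  memLp_trace := hv.memLp_trace.add (hw.memLp_trace.const_smul c)
  exists_approx := by
    obtain ⟨φ, h0, h1, h2, h3⟩ := hv.exists_approx
    obtain ⟨ψ, k0, k1, k2, k3⟩ := hw.exists_approx
    refine ⟨fun m => φ m + c • ψ m, fun m => (h0 m).add ((k0 m).const_smul c), ?_, ?_, ?_⟩
    · exact tendsto_eLpNorm_add_smul (fun m => (h0 m).continuous.aestronglyMeasurable)
        (fun m => (k0 m).continuous.aestronglyMeasurable) hv.memLp.1 hw.memLp.1 h1 k1 c
    · simp only [fun m => gradient_add_smul (h0 m) (k0 m) c]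
      exact tendsto_eLpNorm_add_smul (fun m => (continuous_gradient (h0 m)).aestronglyMeasurable)
        (fun m => (continuous_gradient (k0 m)).aestronglyMeasurable)
        hv.memLp_grad.1 hw.memLp_grad.1 h2 k2 c
    · exact tendsto_eLpNorm_add_smul (fun m => (h0 m).continuous.aestronglyMeasurable)
        (fun m => (k0 m).continuous.aestronglyMeasurable) hv.memLp_trace.1 hw.memLp_trace.1 h3 k3 c

/-- A diagonal argument: for each j, a smooth function within 1/j of the j-th triple is selected. -/
lemma SmoothApprox.of_tendsto {vs Ts : ℕ → Rn (n + 1) → ℝ} {Fs : ℕ → Rn (n + 1) → Rn (n + 1)}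
    (h : ∀ j, SmoothApprox Ω S (vs j) (Fs j) (Ts j)) (hv : MemLp v 2 (volume.restrict Ω))
    (hF : MemLp F 2 (volume.restrict Ω)) (hT : MemLp T 2 (surf S))
    (tv : Tendsto (fun j => eLpNorm (vs j - v) 2 (volume.restrict Ω)) atTop (𝓝 0))
    (tF : Tendsto (fun j => eLpNorm (Fs j - F) 2 (volume.restrict Ω)) atTop (𝓝 0))
    (tT : Tendsto (fun j => eLpNorm (Ts j - T) 2 (surf S)) atTop (𝓝 0)) :
    SmoothApprox Ω S v F T where
  memLp := hv
  memLp_grad := hF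
  memLp_trace := hT
  exists_approx := by
    have key : ∀ j : ℕ, ∃ φ : Rn (n + 1) → ℝ, ContDiff ℝ (⊤ : ℕ∞) φ ∧
        eLpNorm (φ - vs j) 2 (volume.restrict Ω) ≤ (j : ℝ≥0∞)⁻¹ ∧
        eLpNorm (∇ φ - Fs j) 2 (volume.restrict Ω) ≤ (j : ℝ≥0∞)⁻¹ ∧
        eLpNorm (φ - Ts j) 2 (surf S) ≤ (j : ℝ≥0∞)⁻¹ := fun j => by
      obtain ⟨φ, h0, h1, h2, h3⟩ := (h j).exists_approx
      -- For j = 0 the tolerance is ∞, so no shift of the index is needed.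
      have hpos : 0 < (j : ℝ≥0∞)⁻¹ := by simp
      obtain ⟨m, m1, m2, m3⟩ := ((h1.eventually_le_const hpos).and
        ((h2.eventually_le_const hpos).and (h3.eventually_le_const hpos))).exists
      exact ⟨φ m, h0 m, m1, m2, m3⟩
    choose φ h0 h1 h2 h3 using key
    have conv : ∀ {E : Type} [NormedAddCommGroup E] {μ : Measure (Rn (n + 1))}
        {f g : ℕ → Rn (n + 1) → E} {g₀ : Rn (n + 1) → E},
        (∀ j, AEStronglyMeasurable (f j) μ) → (∀ j, AEStronglyMeasurable (g j) μ) →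
        AEStronglyMeasurable g₀ μ → (∀ j : ℕ, eLpNorm (f j - g j) 2 μ ≤ (j : ℝ≥0∞)⁻¹) →
        Tendsto (fun j => eLpNorm (g j - g₀) 2 μ) atTop (𝓝 0) →
        Tendsto (fun j => eLpNorm (f j - g₀) 2 μ) atTop (𝓝 0) := by
      intro E _ μ f g g₀ hf hg hg₀ hfg tg
      refine tendsto_of_tendsto_of_tendsto_of_le_of_le tendsto_const_nhds
        (by simpa using ENNReal.tendsto_inv_nat_nhds_zero.add tg) (fun _ => zero_le) fun j => ?_
      have : f j - g₀ = (f j - g j) + (g j - g₀) := by abel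
      simp only [this]
      refine (eLpNorm_add_le ((hf j).sub (hg j)) ((hg j).sub hg₀) (by norm_num)).trans ?_
      gcongr
      exact hfg j
    refine ⟨φ, h0, ?_, ?_, ?_⟩
    · exact conv (fun j => (h0 j).continuous.aestronglyMeasurable) (fun j => (h j).memLp.1) hv.1 h1 tv
    · exact conv (fun j => (continuous_gradient (h0 j)).aestronglyMeasurable)
        (fun j => (h j).memLp_grad.1) hF.1 h2 tF
    · exact conv (fun j => (h0 j).continuous.aestronglyMeasurable)
        (fun j => (h j).memLp_trace.1) hT.1 h3 tT

lemma eLpNorm_le_add_sub {α E : Type*} [MeasurableSpace α] [NormedAddCommGroup E]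
    {μ : Measure α} {f g : α → E} (hf : AEStronglyMeasurable f μ) (hg : AEStronglyMeasurable g μ) :
    eLpNorm f 2 μ ≤ eLpNorm (f - g) 2 μ + eLpNorm g 2 μ := by
  simpa using eLpNorm_add_le (hf.sub hg) hg (by norm_num : (1 : ℝ≥0∞) ≤ 2)

/-- A trace inequality for smooth functions extends to their limits. -/
lemma SmoothApprox.eLpNorm_trace_le {C : ℝ≥0∞} (hC : C ≠ ⊤)
    (hS : ∀ φ : Rn (n + 1) → ℝ, ContDiff ℝ (⊤ : ℕ∞) φ → eLpNorm φ 2 (surf S) ≤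
      C * (eLpNorm φ 2 (volume.restrict Ω) + eLpNorm (∇ φ) 2 (volume.restrict Ω)))
    (h : SmoothApprox Ω S v F T) : eLpNorm T 2 (surf S) ≤
      C * (eLpNorm v 2 (volume.restrict Ω) + eLpNorm F 2 (volume.restrict Ω)) := by
  obtain ⟨φ, h0, h1, h2, h3⟩ := h.exists_approx
  refine ge_of_tendsto' (f := fun m => eLpNorm (φ m - T) 2 (surf S) +
    C * ((eLpNorm (φ m - v) 2 (volume.restrict Ω) + eLpNorm v 2 (volume.restrict Ω)) +
      (eLpNorm (∇ (φ m) - F) 2 (volume.restrict Ω) + eLpNorm F 2 (volume.restrict Ω))))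
    (x := atTop) ?_ fun m => ?_
  · simpa using h3.add (ENNReal.Tendsto.const_mul
      ((h1.add_const _).add (h2.add_const _)) (.inr hC))
  · have e1 := eLpNorm_le_add_sub h.memLp_trace.1 (h0 m).continuous.aestronglyMeasurable
    rw [eLpNorm_sub_comm] at e1
    refine e1.trans ?_
    gcongr
    refine (hS _ (h0 m)).trans ?_
    gcongr
    · exact eLpNorm_le_add_sub (h0 m).continuous.aestronglyMeasurable h.memLp.1
    · exact eLpNorm_le_add_sub (continuous_gradient (h0 m)).aestronglyMeasurable h.memLp_grad.1

/-- A Poincaré inequality for smooth functions extends to their limits. -/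
lemma SmoothApprox.eLpNorm_le {C : ℝ≥0∞} (hC : C ≠ ⊤)
    (hS : ∀ φ : Rn (n + 1) → ℝ, ContDiff ℝ (⊤ : ℕ∞) φ → eLpNorm φ 2 (volume.restrict Ω) ≤
      C * (eLpNorm φ 2 (surf S) + eLpNorm (∇ φ) 2 (volume.restrict Ω)))
    (h : SmoothApprox Ω S v F T) : eLpNorm v 2 (volume.restrict Ω) ≤
      C * (eLpNorm T 2 (surf S) + eLpNorm F 2 (volume.restrict Ω)) := by
  obtain ⟨φ, h0, h1, h2, h3⟩ := h.exists_approx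
  refine ge_of_tendsto' (f := fun m => eLpNorm (φ m - v) 2 (volume.restrict Ω) +
    C * ((eLpNorm (φ m - T) 2 (surf S) + eLpNorm T 2 (surf S)) +
      (eLpNorm (∇ (φ m) - F) 2 (volume.restrict Ω) + eLpNorm F 2 (volume.restrict Ω))))
    (x := atTop) ?_ fun m => ?_
  · simpa using h1.add (ENNReal.Tendsto.const_mul
      ((h3.add_const _).add (h2.add_const _)) (.inr hC))
  · have e1 := eLpNorm_le_add_sub h.memLp.1 (h0 m).continuous.aestronglyMeasurable
    rw [eLpNorm_sub_comm] at e1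
    refine e1.trans ?_
    gcongr
    refine (hS _ (h0 m)).trans ?_
    gcongr
    · exact eLpNorm_le_add_sub (h0 m).continuous.aestronglyMeasurable h.memLp_trace.1
    · exact eLpNorm_le_add_sub (continuous_gradient (h0 m)).aestronglyMeasurable h.memLp_grad.1

/-- A trace inequality on `S` yields traces on `S` of all limits of smooth functions. -/
lemma SmoothApprox.exists_trace {S' : Set (Rn (n + 1))} {C : ℝ≥0∞} (hC : C ≠ ⊤)
    (hS : ∀ φ : Rn (n + 1) → ℝ, ContDiff ℝ (⊤ : ℕ∞) φ → eLpNorm φ 2 (surf S') ≤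
      C * (eLpNorm φ 2 (volume.restrict Ω) + eLpNorm (∇ φ) 2 (volume.restrict Ω)))
    (hS' : ∀ φ : Rn (n + 1) → ℝ, Continuous φ → MemLp φ 2 (surf S'))
    (h : SmoothApprox Ω S v F T) : ∃ U, SmoothApprox Ω S' v F U := by
  obtain ⟨φ, h0, h1, h2, -⟩ := h.exists_approx
  -- The trace inequality applied to φ m − φ l bounds the distance of the restrictions to `S'` by e
  -- m + e l. They are thus Cauchy in L², and the limit is the required trace, along the same
  -- approximating sequence.
  set e : ℕ → ℝ≥0∞ := fun m => C * (eLpNorm (φ m - v) 2 (volume.restrict Ω) +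
    eLpNorm (∇ (φ m) - F) 2 (volume.restrict Ω))
  have he : Tendsto e atTop (𝓝 0) := by
    simpa using ENNReal.Tendsto.const_mul (h1.add h2) (.inr hC)
  have hm := fun m => hS' (φ m) (h0 m).continuous
  have hsub : ∀ m l, eLpNorm (φ m - φ l) 2 (surf S') ≤ e m + e l := fun m l => by
    have e0 : φ m - φ l = φ m + (-1 : ℝ) • φ l := by simp [sub_eq_add_neg]
    have g0 : ∇ (φ m - φ l) = ∇ (φ m) - ∇ (φ l) := by
      rw [e0, gradient_add_smul (h0 m) (h0 l)]; simp [sub_eq_add_neg]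
    refine (hS (φ m - φ l) ((h0 m).sub (h0 l))).trans ?_
    rw [g0]
    have a1 : eLpNorm (φ m - φ l) 2 (volume.restrict Ω) ≤
        eLpNorm (φ m - v) 2 (volume.restrict Ω) + eLpNorm (φ l - v) 2 (volume.restrict Ω) := by
      rw [show φ m - φ l = (φ m - v) - (φ l - v) by abel]
      exact eLpNorm_sub_le ((h0 m).continuous.aestronglyMeasurable.sub h.memLp.1)
        ((h0 l).continuous.aestronglyMeasurable.sub h.memLp.1) (by norm_num)
    have a2 : eLpNorm (∇ (φ m) - ∇ (φ l)) 2 (volume.restrict Ω) ≤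
        eLpNorm (∇ (φ m) - F) 2 (volume.restrict Ω) +
          eLpNorm (∇ (φ l) - F) 2 (volume.restrict Ω) := by
      rw [show ∇ (φ m) - ∇ (φ l) = (∇ (φ m) - F) - (∇ (φ l) - F) by abel]
      exact eLpNorm_sub_le ((continuous_gradient (h0 m)).aestronglyMeasurable.sub h.memLp_grad.1)
        ((continuous_gradient (h0 l)).aestronglyMeasurable.sub h.memLp_grad.1) (by norm_num)
    exact (mul_le_mul' le_rfl (add_le_add a1 a2)).trans (le_of_eq (by simp only [e]; ring))
  have hcauchy : CauchySeq fun m => (hm m).toLp (φ m) := by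
    refine EMetric.cauchySeq_iff.2 fun η hη => ?_
    obtain ⟨N, hN⟩ := (he.eventually_lt_const (ENNReal.half_pos hη.ne')).exists_forall_of_atTop
    refine ⟨N, fun m hmN l hlN => ?_⟩
    rw [Lp.edist_toLp_toLp]
    calc _ ≤ e m + e l := hsub m l
      _ < η / 2 + η / 2 := ENNReal.add_lt_add (hN m hmN) (hN l hlN)
      _ = η := ENNReal.add_halves η
  obtain ⟨U, hU⟩ := cauchySeq_tendsto_of_complete hcauchy
  refine ⟨U, h.memLp, h.memLp_grad, Lp.memLp U, φ, h0, h1, h2, ?_⟩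
  rw [Lp.tendsto_Lp_iff_tendsto_eLpNorm'] at hU
  exact hU.congr fun m => eLpNorm_congr_ae ((hm m).coeFn_toLp.sub .rfl)

end SmoothApprox

/-! ### Trace and Poincaré inequalities -/

lemma eLpNorm_two_sq {α E : Type*} [MeasurableSpace α] [NormedAddCommGroup E] {μ : Measure α}
    (f : α → E) : eLpNorm f 2 μ ^ 2 = ∫⁻ x, ‖f x‖ₑ ^ 2 ∂μ := by
  have := eLpNorm_nnreal_pow_eq_lintegral (f := f) (μ := μ) (p := 2) (by norm_num)
  simpa using this

/-- Uses D ≤ (D + 1)² in place of a square root of D. -/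
lemma ennreal_le_of_sq_le {x y z D : ℝ≥0∞} (h : x ^ 2 ≤ D * y ^ 2 + D * z ^ 2) :
    x ≤ (D + 1) * (y + z) := by
  rw [← ENNReal.pow_le_pow_left_iff two_ne_zero]
  refine h.trans ?_
  have h1 : y ^ 2 + z ^ 2 ≤ (y + z) ^ 2 := by
    rw [add_sq]; gcongr; exact le_self_add
  have h2 : D ≤ (D + 1) ^ 2 := by
    calc D ≤ D + (D ^ 2 + D + 1) := le_self_add
      _ = (D + 1) ^ 2 := by ring
  calc D * y ^ 2 + D * z ^ 2 = D * (y ^ 2 + z ^ 2) := by ring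
    _ ≤ (D + 1) ^ 2 * (y + z) ^ 2 := by gcongr
    _ = _ := by ring

lemma exists_eLpNorm_graph_le {n : ℕ} {ω : Set (Rn n)} {a b c : Rn n → ℝ} {δ M : ℝ} {L : NNReal}
    (hω : IsOpen ω) (ha : Continuous a) (hb : Continuous b) (hcL : LipschitzWith L c)
    (hc : ∀ x' ∈ ω, c x' ∈ Icc (a x') (b x')) (hδ₀ : 0 < δ) (hδ : ∀ x' ∈ ω, δ ≤ b x' - a x')
    (hM : ∀ x' ∈ ω, b x' - a x' ≤ M) {S : Set (Rn (n + 1))}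
    (hS : ∀ x ∈ S, horiz x ∈ ω ∧ vert x = c (horiz x)) :
    ∃ C : ℝ≥0∞, C ≠ ⊤ ∧ ∀ φ : Rn (n + 1) → ℝ, ContDiff ℝ (⊤ : ℕ∞) φ → eLpNorm φ 2 (surf S) ≤
      C * (eLpNorm φ 2 (volume.restrict (slab ω a b)) +
        eLpNorm (∇ φ) 2 (volume.restrict (slab ω a b))) := by
  obtain ⟨D, hD⟩ := exists_surf_graph_le hcL hS
  set E : ℝ≥0∞ := D * ((ENNReal.ofReal δ)⁻¹ * (2 + 2 * ENNReal.ofReal M ^ 2))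
  have hδ' : ENNReal.ofReal δ ≠ 0 := by simpa using hδ₀
  have hinv : (ENNReal.ofReal δ)⁻¹ ≠ ⊤ := by simpa using hδ₀
  refine ⟨E + 1, by finiteness, fun φ hφ => ennreal_le_of_sq_le ?_⟩
  simp only [eLpNorm_two_sq]
  have hm : Measurable fun x => ‖φ x‖ₑ ^ 2 := (hφ.continuous.enorm.measurable).pow_const 2
  have hj : Measurable fun x' => join x' (c x') :=
    continuous_join.measurable.comp (measurable_id.prodMk hcL.continuous.measurable)
  have h1 : ∫⁻ x, ‖φ x‖ₑ ^ 2 ∂(surf S) ≤ D * ∫⁻ x' in ω, ‖φ (join x' (c x'))‖ₑ ^ 2 := by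
    refine (lintegral_mono' hD le_rfl).trans (le_of_eq ?_)
    rw [lintegral_smul_measure, lintegral_map hm hj]
    rfl
  have h2 := lintegral_graph_le hω ha hb hc hδ hM hφ
  have h3 : ∫⁻ x' in ω, ‖φ (join x' (c x'))‖ₑ ^ 2 ≤ (ENNReal.ofReal δ)⁻¹ *
      (2 * (∫⁻ x in slab ω a b, ‖φ x‖ₑ ^ 2) +
        2 * ENNReal.ofReal M ^ 2 * ∫⁻ x in slab ω a b, ‖∇ φ x‖ₑ ^ 2) := by
    rw [← ENNReal.mul_le_iff_le_inv hδ' ENNReal.ofReal_ne_top]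
    exact h2
  set X := ∫⁻ x in slab ω a b, ‖φ x‖ₑ ^ 2
  set Y := ∫⁻ x in slab ω a b, ‖∇ φ x‖ₑ ^ 2
  calc _ ≤ D * ((ENNReal.ofReal δ)⁻¹ * (2 * X + 2 * ENNReal.ofReal M ^ 2 * Y)) :=
        h1.trans (by gcongr)
    _ ≤ D * ((ENNReal.ofReal δ)⁻¹ * ((2 + 2 * ENNReal.ofReal M ^ 2) * X +
          (2 + 2 * ENNReal.ofReal M ^ 2) * Y)) := by
        gcongr
        · exact le_self_add
        · exact le_add_self
    _ = E * X + E * Y := by simp only [E]; ring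

/-- The constant involves only the height bound M, not the functions a, b, c; the uniformity in ε of
the final estimates comes from here. -/
lemma eLpNorm_slab_le {n : ℕ} {ω : Set (Rn n)} {a b c : Rn n → ℝ} {M : ℝ}
    (hω : IsOpen ω) (ha : Continuous a) (hb : Continuous b) (hcm : Measurable c)
    (hc : ∀ x' ∈ ω, c x' ∈ Icc (a x') (b x'))
    (hM : ∀ x' ∈ ω, b x' - a x' ≤ M) {S : Set (Rn (n + 1))} (hS : ∀ x' ∈ ω, join x' (c x') ∈ S)
    {φ : Rn (n + 1) → ℝ} (hφ : ContDiff ℝ (⊤ : ℕ∞) φ) :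
    eLpNorm φ 2 (volume.restrict (slab ω a b)) ≤
      (2 * ENNReal.ofReal M + 2 * ENNReal.ofReal M ^ 2 + 1) * (eLpNorm φ 2 (surf S) +
        eLpNorm (∇ φ) 2 (volume.restrict (slab ω a b))) := by
  refine ennreal_le_of_sq_le ?_
  simp only [eLpNorm_two_sq]
  have hm : Measurable fun x => ‖φ x‖ₑ ^ 2 := (hφ.continuous.enorm.measurable).pow_const 2
  have hj : Measurable fun x' => join x' (c x') :=
    continuous_join.measurable.comp (measurable_id.prodMk hcm)
  have h1 : ∫⁻ x' in ω, ‖φ (join x' (c x'))‖ₑ ^ 2 ≤ ∫⁻ x, ‖φ x‖ₑ ^ 2 ∂(surf S) := by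
    rw [← lintegral_map hm hj]
    exact lintegral_mono' (restrict_map_graph_le_surf hcm hS) le_rfl
  refine (lintegral_slab_le hω ha hb hcm hc hM hφ).trans ?_
  gcongr
  · exact le_self_add
  · exact le_add_self

/-! ### The two-component domain -/

/-- The geometric assumptions on the two-component domain at a fixed scale. -/
structure IsAdmissible {n : ℕ} (ω : Set (Rn n)) (ℓ : ℝ) (g : Rn n → ℝ) (k ε : ℝ) : Prop where
  isOpen : IsOpen ω
  isBounded : Bornology.IsBounded ω
  exists_lipschitz : ∃ L, LipschitzWith L (height g k ε)
  height_pos : ∀ x', 0 < height g k ε x'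
  exists_gap : ∃ δ, 0 < δ ∧ δ < ℓ ∧ ∀ x' ∈ ω, height g k ε x' + δ ≤ ℓ

/-- The height attains its maximum on the compact closure of ω, so the pointwise bound by ℓ becomes
a uniform gap, namely ℓ minus that maximum. -/
lemma IsBoundedSmoothDomain.isAdmissible {n : ℕ} {ω : Set (Rn n)} (hω : IsBoundedSmoothDomain ω)
    {ℓ : ℝ} {g : Rn n → ℝ} {k ε : ℝ} (g_pos : ∀ y, 0 < g y) (g_lip : ∃ L, LipschitzWith L g)
    (hε : 0 < ε) (h : ∀ x' ∈ closure ω, height g k ε x' < ℓ) : IsAdmissible ω ℓ g k ε := by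
  have hlip : ∃ L, LipschitzWith L (height g k ε) := by
    obtain ⟨L, hL⟩ := g_lip
    have h1 : LipschitzWith ‖ε⁻¹‖₊ (fun x : Rn n => ε⁻¹ • x) := lipschitzWith_smul _
    have h2 : LipschitzWith ‖ε ^ k‖₊ (fun x : ℝ => ε ^ k • x) := lipschitzWith_smul _
    exact ⟨_, (h2.comp (hL.comp h1))⟩
  have hpos : ∀ x', 0 < height g k ε x' := fun x' => mul_pos (Real.rpow_pos_of_pos hε k) (g_pos _)
  refine ⟨hω.isOpen, hω.isBounded, hlip, hpos, ?_⟩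
  obtain ⟨L, hL⟩ := hlip
  obtain ⟨z, hz, hmax⟩ := hω.isBounded.isCompact_closure.exists_isMaxOn
    hω.isConnected.nonempty.closure hL.continuous.continuousOn
  refine ⟨(ℓ - height g k ε z), ?_, ?_, fun x' hx' => ?_⟩
  · linarith [h z hz]
  · linarith [hpos z]
  · have : height g k ε x' ≤ height g k ε z := hmax (subset_closure hx')
    linarith

namespace IsAdmissible

variable {n : ℕ} {ω : Set (Rn n)} {ℓ : ℝ} {g : Rn n → ℝ} {k ε : ℝ}

lemma length_pos (H : IsAdmissible ω ℓ g k ε) : 0 < ℓ := by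
  obtain ⟨δ, h1, h2, -⟩ := H.exists_gap
  linarith

lemma height_lt (H : IsAdmissible ω ℓ g k ε) {x' : Rn n} (hx : x' ∈ ω) :
    height g k ε x' < ℓ := by
  obtain ⟨δ, h1, h2, h3⟩ := H.exists_gap
  linarith [h3 x' hx]

lemma continuous_height (H : IsAdmissible ω ℓ g k ε) : Continuous (height g k ε) :=
  H.exists_lipschitz.choose_spec.continuous

lemma upper_eq_slab (H : IsAdmissible ω ℓ g k ε) :
    upper ω ℓ g k ε = slab ω (height g k ε) (fun _ => ℓ) := by
  ext x
  simp only [upper, cyl, slab, mem_ofPred_eq, mem_Ioo]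
  have := H.height_pos (horiz x)
  have := H.length_pos
  grind

lemma lower_eq_slab (H : IsAdmissible ω ℓ g k ε) :
    lower ω ℓ g k ε = slab ω (fun _ => -ℓ) (height g k ε) := by
  ext x
  simp only [lower, cyl, slab, mem_ofPred_eq, mem_Ioo]
  exact ⟨fun ⟨⟨h1, h2, _⟩, h4⟩ => ⟨h1, h2, h4⟩,
    fun ⟨h1, h2, h4⟩ => ⟨⟨h1, h2, h4.trans (H.height_lt h1)⟩, h4⟩⟩

lemma isOpen_upper (H : IsAdmissible ω ℓ g k ε) : IsOpen (upper ω ℓ g k ε) := by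
  rw [H.upper_eq_slab]; exact isOpen_slab H.isOpen H.continuous_height continuous_const

lemma isOpen_lower (H : IsAdmissible ω ℓ g k ε) : IsOpen (lower ω ℓ g k ε) := by
  rw [H.lower_eq_slab]; exact isOpen_slab H.isOpen continuous_const H.continuous_height

lemma isOpen_cyl (H : IsAdmissible ω ℓ g k ε) : IsOpen (cyl ω ℓ) :=
  isOpen_slab (a := fun _ => -ℓ) (b := fun _ => ℓ) H.isOpen continuous_const continuous_const

lemma volume_interface (H : IsAdmissible ω ℓ g k ε) : volume (interface ω ℓ g k ε) = 0 :=
  volume_graph_eq_zero H.continuous_height fun _ hx => hx.2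

lemma exists_surf_interface_le (H : IsAdmissible ω ℓ g k ε) : ∃ C : NNReal,
    surf (interface ω ℓ g k ε) ≤
      C • (volume.restrict ω).map (fun x' => join x' (height g k ε x')) :=
  exists_surf_graph_le H.exists_lipschitz.choose_spec fun _ hx => ⟨hx.1.1, hx.2⟩

lemma isFiniteMeasure_surf (H : IsAdmissible ω ℓ g k ε) :
    IsFiniteMeasure (surf (interface ω ℓ g k ε)) := by
  obtain ⟨C, hC⟩ := H.exists_surf_interface_le
  have : IsFiniteMeasure (volume.restrict ω) :=
    isFiniteMeasure_restrict.2 H.isBounded.measure_lt_top.ne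
  exact isFiniteMeasure_of_le _ hC

/-- Lets almost-everywhere statements about h on the base be pulled back to the interface: the
surface measure is dominated by a multiple of the image of Lebesgue measure under the graph map, and
projection inverts that map. -/
lemma quasiMeasurePreserving_horiz (H : IsAdmissible ω ℓ g k ε) :
    Measure.QuasiMeasurePreserving horiz (surf (interface ω ℓ g k ε)) volume := by
  refine ⟨continuous_horiz.measurable, ?_⟩
  obtain ⟨C, hC⟩ := H.exists_surf_interface_le
  refine Measure.AbsolutelyContinuous.mk fun N hN h0 => ?_
  rw [Measure.map_apply continuous_horiz.measurable hN]
  refine le_antisymm ((hC _).trans ?_) zero_le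
  have hj : Measurable fun x' => join x' (height g k ε x') :=
    continuous_join.measurable.comp (measurable_id.prodMk H.continuous_height.measurable)
  rw [Measure.smul_apply, Measure.map_apply hj (continuous_horiz.measurable hN)]
  have : (fun x' => join x' (height g k ε x')) ⁻¹' (horiz ⁻¹' N) = N := by ext; simp
  rw [this, Measure.restrict_apply hN, measure_mono_null inter_subset_left h0, smul_zero]

lemma isBounded_cyl (H : IsAdmissible ω ℓ g k ε) : Bornology.IsBounded (cyl ω ℓ) := by
  obtain ⟨R, hR⟩ := H.isBounded.exists_norm_le
  refine (isBounded_iff_forall_norm_le).2 ⟨|R| + ℓ, fun x hx => ?_⟩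
  refine le_of_sq_le_sq ?_ (by have := H.length_pos; positivity)
  have h1 := hR _ hx.1
  have h2 := hx.2
  have h3 := H.length_pos
  have h4 : ‖horiz x‖ ^ 2 ≤ |R| ^ 2 := by gcongr; exact h1.trans (le_abs_self R)
  have h5 : vert x ^ 2 ≤ ℓ ^ 2 := sq_le_sq' h2.1.le h2.2.le
  rw [norm_sq_eq_horiz_vert]
  nlinarith [abs_nonneg R, mul_nonneg (abs_nonneg R) h3.le]

lemma memLp_interface (H : IsAdmissible ω ℓ g k ε) {φ : Rn (n + 1) → ℝ} (hφ : Continuous φ) :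
    MemLp φ 2 (surf (interface ω ℓ g k ε)) := by
  have := H.isFiniteMeasure_surf
  obtain ⟨R, hR⟩ := H.isBounded_cyl.isCompact_closure.exists_bound_of_continuousOn hφ.continuousOn
  refine MemLp.of_bound hφ.aestronglyMeasurable R ?_
  refine ae_restrict_of_forall_mem ?_ fun x hx => hR x (subset_closure hx.1)
  exact (H.isOpen_cyl.measurableSet.inter (isClosed_eq continuous_vert
    (H.continuous_height.comp continuous_horiz)).measurableSet)

lemma exists_trace_upper_le (H : IsAdmissible ω ℓ g k ε) : ∃ C : ℝ≥0∞, C ≠ ⊤ ∧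
    ∀ φ : Rn (n + 1) → ℝ, ContDiff ℝ (⊤ : ℕ∞) φ → eLpNorm φ 2 (surf (interface ω ℓ g k ε)) ≤
      C * (eLpNorm φ 2 (volume.restrict (upper ω ℓ g k ε)) +
        eLpNorm (∇ φ) 2 (volume.restrict (upper ω ℓ g k ε))) := by
  obtain ⟨L, hL⟩ := H.exists_lipschitz
  obtain ⟨δ, h1, h2, h3⟩ := H.exists_gap
  rw [H.upper_eq_slab]
  exact exists_eLpNorm_graph_le (M := ℓ) H.isOpen H.continuous_height continuous_const hL
    (fun x' hx => ⟨le_rfl, (H.height_lt hx).le⟩) h1 (fun x' hx => by linarith [h3 x' hx])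
    (fun x' hx => by linarith [H.height_pos x']) fun _ hx => ⟨hx.1.1, hx.2⟩

lemma exists_trace_lower_le (H : IsAdmissible ω ℓ g k ε) : ∃ C : ℝ≥0∞, C ≠ ⊤ ∧
    ∀ φ : Rn (n + 1) → ℝ, ContDiff ℝ (⊤ : ℕ∞) φ → eLpNorm φ 2 (surf (interface ω ℓ g k ε)) ≤
      C * (eLpNorm φ 2 (volume.restrict (lower ω ℓ g k ε)) +
        eLpNorm (∇ φ) 2 (volume.restrict (lower ω ℓ g k ε))) := by
  obtain ⟨L, hL⟩ := H.exists_lipschitz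
  have hℓ := H.length_pos
  rw [H.lower_eq_slab]
  -- The interface has positive height, so the segments below it are longer than ℓ.
  exact exists_eLpNorm_graph_le (M := 2 * ℓ) (δ := ℓ) H.isOpen continuous_const
    H.continuous_height hL (fun x' hx => ⟨by linarith [H.height_pos x'], le_rfl⟩) hℓ
    (fun x' hx => by linarith [H.height_pos x']) (fun x' hx => by linarith [H.height_lt hx])
    fun _ hx => ⟨hx.1.1, hx.2⟩

/-- The point is a limit of points of `u` on the same vertical line, but its height excludes it from
the cylinder and so from the interior of `u`. -/
lemma join_mem_frontier {x' : Rn n} {t : ℝ} (ht : t ∉ Ioo (-ℓ) ℓ) {u : Set (Rn (n + 1))}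
    (hu : u ⊆ cyl ω ℓ) (h : ∃ᶠ s in 𝓝 t, join x' s ∈ u) : join x' t ∈ frontier u := by
  refine ⟨?_, fun h' => ?_⟩
  · rw [mem_closure_iff_frequently]
    have : Tendsto (fun s => join x' s) (𝓝 t) (𝓝 (join x' t)) :=
      (continuous_join.comp (continuous_const.prodMk continuous_id)).tendsto t
    exact this.frequently h
  · have := (hu (interior_subset h')).2
    rw [vert_join] at this
    exact ht this

lemma join_top_mem (H : IsAdmissible ω ℓ g k ε) {x' : Rn n} (hx : x' ∈ ω) :
    join x' ℓ ∈ frontier (cyl ω ℓ) ∩ frontier (upper ω ℓ g k ε) := by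
  have key : ∃ᶠ s in 𝓝 ℓ, join x' s ∈ upper ω ℓ g k ε := by
    refine ((?_ : ∀ᶠ s in 𝓝[<] ℓ, join x' s ∈ upper ω ℓ g k ε).frequently).filter_mono
      nhdsWithin_le_nhds
    filter_upwards [Ioo_mem_nhdsLT (H.height_lt hx)] with s hs
    rw [H.upper_eq_slab]
    simpa [slab, hx] using hs
  exact ⟨join_mem_frontier (by simp) le_rfl (key.mono fun s hs => hs.1),
    join_mem_frontier (by simp) (fun _ hy => hy.1) key⟩

lemma join_bottom_mem (H : IsAdmissible ω ℓ g k ε) {x' : Rn n} (hx : x' ∈ ω) :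
    join x' (-ℓ) ∈ frontier (cyl ω ℓ) ∩ frontier (lower ω ℓ g k ε) := by
  have key : ∃ᶠ s in 𝓝 (-ℓ), join x' s ∈ lower ω ℓ g k ε := by
    refine ((?_ : ∀ᶠ s in 𝓝[>] (-ℓ), join x' s ∈ lower ω ℓ g k ε).frequently).filter_mono
      nhdsWithin_le_nhds
    filter_upwards [Ioo_mem_nhdsGT (show -ℓ < height g k ε x' by
      linarith [H.height_pos x', H.length_pos])] with s hs
    rw [H.lower_eq_slab]
    simpa [slab, hx] using hs
  exact ⟨join_mem_frontier (by simp) le_rfl (key.mono fun s hs => hs.1),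
    join_mem_frontier (by simp) (fun _ hy => hy.1) key⟩

end IsAdmissible

/-- A Poincaré constant for functions on the two-component domain, uniform in the scale. -/
def poincareConst (ℓ : ℝ) : ℝ≥0∞ :=
  2 * ENNReal.ofReal (2 * ℓ) + 2 * ENNReal.ofReal (2 * ℓ) ^ 2 + 1

lemma poincareConst_ne_top (ℓ : ℝ) : poincareConst ℓ ≠ ⊤ := by
  unfold poincareConst; finiteness

namespace IsAdmissible

variable {n : ℕ} {ω : Set (Rn n)} {ℓ : ℝ} {g : Rn n → ℝ} {k ε : ℝ}

lemma eLpNorm_upper_le (H : IsAdmissible ω ℓ g k ε) {φ : Rn (n + 1) → ℝ}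
    (hφ : ContDiff ℝ (⊤ : ℕ∞) φ) : eLpNorm φ 2 (volume.restrict (upper ω ℓ g k ε)) ≤
      poincareConst ℓ * (eLpNorm φ 2 (surf (frontier (cyl ω ℓ) ∩ frontier (upper ω ℓ g k ε))) +
        eLpNorm (∇ φ) 2 (volume.restrict (upper ω ℓ g k ε))) := by
  have h := eLpNorm_slab_le (c := fun _ => ℓ) (M := 2 * ℓ) H.isOpen H.continuous_height
    continuous_const measurable_const (fun x' hx => ⟨(H.height_lt hx).le, le_rfl⟩)
    (fun x' hx => by linarith [H.height_pos x', H.length_pos]) (fun _ hx => H.join_top_mem hx) hφ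
  rwa [← H.upper_eq_slab] at h

lemma eLpNorm_lower_le (H : IsAdmissible ω ℓ g k ε) {φ : Rn (n + 1) → ℝ}
    (hφ : ContDiff ℝ (⊤ : ℕ∞) φ) : eLpNorm φ 2 (volume.restrict (lower ω ℓ g k ε)) ≤
      poincareConst ℓ * (eLpNorm φ 2 (surf (frontier (cyl ω ℓ) ∩ frontier (lower ω ℓ g k ε))) +
        eLpNorm (∇ φ) 2 (volume.restrict (lower ω ℓ g k ε))) := by
  have h := eLpNorm_slab_le (c := fun _ => -ℓ) (M := 2 * ℓ) H.isOpen continuous_const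
    H.continuous_height measurable_const
    (fun x' hx => ⟨le_rfl, by linarith [H.height_pos x', H.length_pos]⟩)
    (fun x' hx => by linarith [H.height_lt hx]) (fun _ hx => H.join_bottom_mem hx) hφ
  rwa [← H.lower_eq_slab] at h

end IsAdmissible

/-! ### Variational inequalities in Hilbert spaces -/

section Stampacchia

variable {H : Type*} [NormedAddCommGroup H] [InnerProductSpace ℝ H] [CompleteSpace H]

/-- The metric projection onto a closed convex set. -/
lemma exists_projection {K : Set H} (hne : K.Nonempty) (hcl : IsClosed K) (hconv : Convex ℝ K) :
    ∃ P : H → H, (∀ x, P x ∈ K) ∧ ∀ x, ∀ w ∈ K, inner ℝ (x - P x) (w - P x) ≤ 0 := by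
  have key : ∀ x, ∃ v ∈ K, ∀ w ∈ K, inner ℝ (x - v) (w - v) ≤ 0 := fun x => by
    obtain ⟨v, hv, h⟩ := exists_norm_eq_iInf_of_complete_convex hne hcl.isComplete hconv x
    exact ⟨v, hv, (norm_eq_iInf_iff_real_inner_le_zero hconv hv).1 h⟩
  choose P h1 h2 using key
  exact ⟨P, h1, h2⟩

/-- Adding the obtuse-angle inequalities at the two projections gives ‖Px − Py‖² ≤ ⟨x − y, Px − Py⟩;
Cauchy–Schwarz concludes. -/
lemma norm_projection_sub_le {H : Type*} [NormedAddCommGroup H] [InnerProductSpace ℝ H] {K : Set H} {P : H → H} (h1 : ∀ x, P x ∈ K)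
    (h2 : ∀ x, ∀ w ∈ K, inner ℝ (x - P x) (w - P x) ≤ 0) (x y : H) :
    ‖P x - P y‖ ≤ ‖x - y‖ := by
  have e1 := h2 x (P y) (h1 y)
  have e2 := h2 y (P x) (h1 x)
  have e3 : ‖P x - P y‖ * ‖P x - P y‖ ≤ inner ℝ (x - y) (P x - P y) := by
    rw [← real_inner_self_eq_norm_mul_norm]
    have : inner ℝ (x - y) (P x - P y) - inner ℝ (P x - P y) (P x - P y) =
        -inner ℝ (x - P x) (P y - P x) - inner ℝ (y - P y) (P x - P y) := by
      simp only [inner_sub_left, inner_sub_right]; ring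
    linarith
  have e4 := real_inner_le_norm (x - y) (P x - P y)
  nlinarith [norm_nonneg (P x - P y), norm_nonneg (x - y)]

/-- The Lions–Stampacchia theorem, with coercivity only on differences of elements of `K`. -/
theorem exists_variational_inequality {K : Set H} (hne : K.Nonempty) (hcl : IsClosed K)
    (hconv : Convex ℝ K) (B : H →L[ℝ] H) {c : ℝ} (hc : 0 < c)
    (hB : ∀ u ∈ K, ∀ v ∈ K, c * ‖u - v‖ ^ 2 ≤ inner ℝ (B (u - v)) (u - v)) (f : H) :
    ∃ u ∈ K, ∀ v ∈ K, inner ℝ f (v - u) ≤ inner ℝ (B u) (v - u) := by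
  obtain ⟨P, hP1, hP2⟩ := exists_projection hne hcl hconv
  -- Adding c to the operator norm guarantees M > 0 and c ≤ M without further case distinctions.
  set M := ‖B‖ + c
  have hM : 0 < M := by positivity
  have hcM : c ≤ M := by simp [M]
  -- This step length minimizes 1 − 2ρc + ρ²M², with minimum q = 1 − c²/M² < 1, so u ↦ P(u − ρ(Bu −
  -- f)) contracts with ratio √q.
  set ρ := c / M ^ 2
  have hρ : 0 < ρ := by positivity
  set q := 1 - c ^ 2 / M ^ 2
  have hq0 : 0 ≤ q := by
    have : c ^ 2 / M ^ 2 ≤ 1 := (div_le_one (by positivity)).2 (by gcongr)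
    simp only [q]; linarith
  have hq1 : q < 1 := by
    have : 0 < c ^ 2 / M ^ 2 := by positivity
    simp only [q]; linarith
  let T : K → K := fun u => ⟨P (u - ρ • (B u - f)), hP1 _⟩
  have hT : ContractingWith (√q).toNNReal T := by
    refine ⟨?_, LipschitzWith.of_dist_le_mul fun u v => ?_⟩
    · rw [Real.toNNReal_lt_one]
      simpa using (Real.sqrt_lt' one_pos).2 (by simpa using hq1)
    · rw [Subtype.dist_eq, Subtype.dist_eq, dist_eq_norm, dist_eq_norm]
      refine (norm_projection_sub_le hP1 hP2 _ _).trans ?_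
      have e0 : (u : H) - ρ • (B u - f) - (v - ρ • (B v - f)) =
          ((u : H) - v) - ρ • B ((u : H) - v) := by
        rw [map_sub]; module
      rw [e0]
      set d := (u : H) - v
      refine le_of_sq_le_sq ?_ (mul_nonneg (NNReal.coe_nonneg _) (norm_nonneg _))
      rw [mul_pow, Real.coe_toNNReal _ (Real.sqrt_nonneg q), Real.sq_sqrt hq0, norm_sub_sq_real, inner_smul_right,
        norm_smul, mul_pow, Real.norm_eq_abs, sq_abs, real_inner_comm]
      have e1 := hB u u.2 v v.2
      have e2 : ‖B d‖ ^ 2 ≤ M ^ 2 * ‖d‖ ^ 2 := by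
        rw [← mul_pow]
        have : ‖B d‖ ≤ M * ‖d‖ := (B.le_opNorm d).trans (by gcongr; simp [M, hc.le])
        gcongr
      have e3 : ρ ^ 2 * ‖B d‖ ^ 2 ≤ ρ ^ 2 * (M ^ 2 * ‖d‖ ^ 2) := by gcongr
      have e4 : ρ * (c * ‖d‖ ^ 2) ≤ ρ * inner ℝ (B d) d := by gcongr
      have e5 : q * ‖d‖ ^ 2 = ‖d‖ ^ 2 - 2 * (ρ * (c * ‖d‖ ^ 2)) + ρ ^ 2 * (M ^ 2 * ‖d‖ ^ 2) := by
        simp only [q, ρ]; field_simp; ring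
      linarith
  have : CompleteSpace K := hcl.completeSpace_coe
  have : Nonempty K := hne.to_subtype
  set u := ContractingWith.fixedPoint T hT
  have hu : P (u - ρ • (B u - f)) = u := congrArg Subtype.val hT.fixedPoint_isFixedPt
  refine ⟨u, u.2, fun v hv => ?_⟩
  -- At the fixed point the obtuse-angle inequality of the projection is ρ times the desired
  -- variational inequality.
  have := hP2 (u - ρ • (B u - f)) v hv
  rw [hu, sub_right_comm, sub_self, zero_sub, inner_neg_left, inner_smul_left, inner_sub_left] at this
  simp only [conj_trivial, Left.neg_nonpos_iff] at this
  have := nonneg_of_mul_nonneg_right this hρ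
  linarith

end Stampacchia

/-! ### Multiplication operators -/

lemma exists_multiplication_clm {X E : Type*} [MeasurableSpace X] {μ : Measure X}
    [NormedAddCommGroup E] [NormedSpace ℝ E] (a : X → E →ₗ[ℝ] E)
    (ha : ∀ F : X → E, AEStronglyMeasurable F μ → AEStronglyMeasurable (fun x => a x (F x)) μ)
    {β : ℝ} (hβ : ∀ᵐ x ∂μ, ∀ y, ‖a x y‖ ≤ β * ‖y‖) :
    ∃ T : Lp E 2 μ →L[ℝ] Lp E 2 μ, ∀ F, T F =ᵐ[μ] fun x => a x (F x) := by
  have hm : ∀ F : Lp E 2 μ, MemLp (fun x => a x (F x)) 2 μ := fun F =>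
    (Lp.memLp F).of_le_mul (ha F (Lp.memLp F).1) (hβ.mono fun x hx => hx _)
  let T : Lp E 2 μ →ₗ[ℝ] Lp E 2 μ :=
    { toFun := fun F => (hm F).toLp _
      map_add' := fun F G => by
        ext1
        filter_upwards [(hm (F + G)).coeFn_toLp, (hm F).coeFn_toLp, (hm G).coeFn_toLp,
          Lp.coeFn_add F G, Lp.coeFn_add ((hm F).toLp _) ((hm G).toLp _)] with x h1 h2 h3 h4 h5
        rw [h1, h5, h4, Pi.add_apply, Pi.add_apply, map_add, h2, h3]
      map_smul' := fun c F => by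
        ext1
        filter_upwards [(hm (c • F)).coeFn_toLp, (hm F).coeFn_toLp,
          Lp.coeFn_smul c F, Lp.coeFn_smul c ((hm F).toLp _)] with x h1 h2 h3 h4
        rw [RingHom.id_apply, h1, h4, h3, Pi.smul_apply, Pi.smul_apply, map_smul, h2] }
  refine ⟨T.mkContinuous β fun F => ?_, fun F => (hm F).coeFn_toLp⟩
  refine Lp.norm_le_mul_norm_of_ae_le_mul ?_
  filter_upwards [(hm F).coeFn_toLp, hβ] with x h1 h2
  change ‖(hm F).toLp _ x‖ ≤ _
  rw [h1]
  exact h2 _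

/-! ### Periodicity -/

lemma quasiMeasurePreserving_smul_Rn {d : ℕ} {r : ℝ} (hr : r ≠ 0) :
    Measure.QuasiMeasurePreserving (fun x : Rn d => r • x) volume volume := by
  refine ⟨measurable_const_smul r, Measure.AbsolutelyContinuous.mk fun N hN h0 => ?_⟩
  rw [Measure.map_apply (measurable_const_smul r) hN]
  exact (Measure.addHaar_preimage_smul volume hr N).trans (by simp [h0])

lemma ae_forall_notMem_range_int {d : ℕ} :
    ∀ᵐ y : Rn d, ∀ i, ∀ m : ℤ, y i ≠ m := by
  refine ae_all_iff.2 fun i => ae_all_iff.2 fun m => ?_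
  have h := EuclideanSpace.volume_preserving_symm_measurableEquiv_toLp (Fin d)
  exact h.quasiMeasurePreserving.ae (Measure.ae_eval_ne (μ := fun _ : Fin d => volume) i (m : ℝ))

/-- Almost every point has an integer translate in the open cell. Since there are only countably
many integer translations, the exceptional null sets can be united. -/
lemma ae_of_ae_unitCell {d : ℕ} {p : Rn d → Prop}
    (hper : ∀ i : Fin d, ∀ᵐ y : Rn d, p (y + EuclideanSpace.single i 1) ↔ p y)
    (h : ∀ᵐ y ∂(volume.restrict (unitCell d)), p y) : ∀ᵐ y, p y := by
  have htr : ∀ (z : Rn d) {q : Rn d → Prop}, (∀ᵐ y, q y) → ∀ᵐ y, q (y + z) := fun z q hq =>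
    (measurePreserving_add_right volume z).quasiMeasurePreserving.ae hq
  -- The vectors leaving p invariant almost everywhere form a subgroup; containing the basis
  -- vectors, it contains the integer lattice.
  let G : AddSubgroup (Rn d) :=
    { carrier := {z | ∀ᵐ y, p (y + z) ↔ p y}
      zero_mem' := by simp
      add_mem' := fun {z w} hz hw => by
        change ∀ᵐ y, p (y + (z + w)) ↔ p y
        filter_upwards [htr z hw, hz] with y h1 h2
        rw [← add_assoc]; exact h1.trans h2
      neg_mem' := fun {z} hz => by
        change ∀ᵐ y, p (y + -z) ↔ p y
        filter_upwards [htr (-z) hz] with y h1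
        simpa using h1.symm }
  have hG : ∀ m : Fin d → ℤ, WithLp.toLp 2 (fun i => (m i : ℝ)) ∈ G := fun m => by
    have : (WithLp.toLp 2 (fun i => (m i : ℝ)) : Rn d) =
        ∑ i, m i • EuclideanSpace.single i (1 : ℝ) := by
      ext j
      simp [Finset.sum_apply, Pi.single_apply]
    rw [this]
    exact G.sum_mem fun i _ => G.zsmul_mem (hper i) _
  have hcell : MeasurableSet (unitCell d) := by
    have : unitCell d = ⋂ i, (fun y : Rn d => y i) ⁻¹' Ioo 0 1 := by
      ext; simp [unitCell]
    rw [this]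
    exact MeasurableSet.iInter fun i =>
      (show Continuous fun y : Rn d => y i by fun_prop).measurable measurableSet_Ioo
  have h' := (ae_restrict_iff' hcell).1 h
  have h1 : ∀ᵐ y : Rn d, ∀ m : Fin d → ℤ, p (y + WithLp.toLp 2 (fun i => (m i : ℝ))) ↔ p y :=
    ae_all_iff.2 hG
  have h2 : ∀ᵐ y : Rn d, ∀ m : Fin d → ℤ, y + WithLp.toLp 2 (fun i => (m i : ℝ)) ∈ unitCell d →
      p (y + WithLp.toLp 2 (fun i => (m i : ℝ))) := ae_all_iff.2 fun m => htr _ h'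
  filter_upwards [h1, h2, ae_forall_notMem_range_int] with y a1 a2 a3
  -- Translation by the negative integer parts leaves the fractional parts, which are strictly
  -- positive because no coordinate of y is an integer.
  refine (a1 fun i => -⌊y i⌋).1 (a2 _ fun i => ?_)
  have e : (y + WithLp.toLp 2 (fun i => ((-⌊y i⌋ : ℤ) : ℝ))) i = Int.fract (y i) := by
    simp [Int.fract, sub_eq_add_neg]
  rw [e]
  refine ⟨lt_of_le_of_ne (Int.fract_nonneg _) fun h0 => a3 i ⌊y i⌋ ?_, Int.fract_lt_one _⟩
  have := Int.self_sub_floor (y i)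
  linarith

/-! ### Uniqueness of traces -/

section Trace

variable {n : ℕ} {Ω S : Set (Rn (n + 1))} {v : Rn (n + 1) → ℝ}
  {F : Rn (n + 1) → Rn (n + 1)} {T U : Rn (n + 1) → ℝ}

/-- The difference T − U approximates the zero function with zero gradient, so the trace inequality
forces its norm to vanish. -/
lemma SmoothApprox.ae_eq_trace_of_le {C : ℝ≥0∞} (hC : C ≠ ⊤)
    (hS : ∀ φ : Rn (n + 1) → ℝ, ContDiff ℝ (⊤ : ℕ∞) φ → eLpNorm φ 2 (surf S) ≤
      C * (eLpNorm φ 2 (volume.restrict Ω) + eLpNorm (∇ φ) 2 (volume.restrict Ω)))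
    (hT : SmoothApprox Ω S v F T) (hU : SmoothApprox Ω S v F U) : T =ᵐ[surf S] U := by
  have h := (hT.add_smul hU (-1)).eLpNorm_trace_le hC hS
  have e1 : v + (-1 : ℝ) • v = 0 := by simp
  have e2 : F + (-1 : ℝ) • F = 0 := by simp
  rw [e1, e2, eLpNorm_zero, eLpNorm_zero, add_zero, mul_zero] at h
  have h' := (eLpNorm_eq_zero_iff (hT.add_smul hU (-1)).memLp_trace.1 two_ne_zero).1
    (le_antisymm h zero_le)
  filter_upwards [h'] with x hx
  simp only [Pi.add_apply, Pi.smul_apply, smul_eq_mul, Pi.zero_apply] at hx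
  linarith

lemma SmoothApprox.ae_eq_trace {C : ℝ≥0∞} (hC : C ≠ ⊤) (hΩ : IsOpen Ω)
    (hS : ∀ φ : Rn (n + 1) → ℝ, ContDiff ℝ (⊤ : ℕ∞) φ → eLpNorm φ 2 (surf S) ≤
      C * (eLpNorm φ 2 (volume.restrict Ω) + eLpNorm (∇ φ) 2 (volume.restrict Ω)))
    (hF : IsWeakGrad Ω v F) (hT : SmoothApprox Ω S v F T) : T =ᵐ[surf S] trace Ω S v := by
  have hex : ∃ T, IsTrace Ω S v T := ⟨T, hT.isTrace hΩ hF⟩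
  have h : IsTrace Ω S v (trace Ω S v) := by
    rw [trace, dif_pos hex]; exact hex.choose_spec
  exact hT.ae_eq_trace_of_le hC hS
    (h.smoothApprox.congr .rfl (h.memH1.isWeakGrad.ae_eq hΩ hF .rfl) .rfl)

end Trace

/-! ### The graph of the gradient and jump operators -/

/-- `F` is the gradient and `J` is the jump of the function `v`, whose trace vanishes on the
boundary of the cylinder. -/
structure HasGradJump {n : ℕ} (ω : Set (Rn n)) (ℓ : ℝ) (g : Rn n → ℝ) (k ε : ℝ)
    (v : Rn (n + 1) → ℝ) (F : Rn (n + 1) → Rn (n + 1)) (J : Rn (n + 1) → ℝ) : Prop where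
  weak_upper : IsWeakGrad (upper ω ℓ g k ε) v F
  weak_lower : IsWeakGrad (lower ω ℓ g k ε) v F
  boundary_upper :
    SmoothApprox (upper ω ℓ g k ε) (frontier (cyl ω ℓ) ∩ frontier (upper ω ℓ g k ε)) v F 0
  boundary_lower :
    SmoothApprox (lower ω ℓ g k ε) (frontier (cyl ω ℓ) ∩ frontier (lower ω ℓ g k ε)) v F 0
  exists_trace : ∃ T U, SmoothApprox (upper ω ℓ g k ε) (interface ω ℓ g k ε) v F T ∧
    SmoothApprox (lower ω ℓ g k ε) (interface ω ℓ g k ε) v F U ∧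
    J =ᵐ[surf (interface ω ℓ g k ε)] T - U

section Domain

variable {n : ℕ} {ω : Set (Rn n)} {ℓ : ℝ} {g : Rn n → ℝ} {k ε : ℝ}

lemma cyl_diff_interface : cyl ω ℓ \ interface ω ℓ g k ε = upper ω ℓ g k ε ∪ lower ω ℓ g k ε := by
  ext x
  simp only [interface, upper, lower, Set.mem_sdiff, mem_union, mem_ofPred_eq]
  constructor
  · rintro ⟨h1, h2⟩
    rcases lt_trichotomy (vert x) (height g k ε (horiz x)) with h | h | h
    · exact .inr ⟨h1, h⟩
    · exact absurd ⟨h1, h⟩ h2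
    · exact .inl ⟨h1, h⟩
  · rintro (⟨h1, h⟩ | ⟨h1, h⟩)
    · exact ⟨h1, fun h' => h.ne' h'.2⟩
    · exact ⟨h1, fun h' => h.ne h'.2⟩

lemma disjoint_upper_lower : Disjoint (upper ω ℓ g k ε) (lower ω ℓ g k ε) :=
  Set.disjoint_left.2 fun _ h1 h2 => lt_asymm h1.2 h2.2

lemma upper_subset_diff : upper ω ℓ g k ε ⊆ cyl ω ℓ \ interface ω ℓ g k ε := by
  rw [cyl_diff_interface]; exact subset_union_left

lemma lower_subset_diff : lower ω ℓ g k ε ⊆ cyl ω ℓ \ interface ω ℓ g k ε := by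
  rw [cyl_diff_interface]; exact subset_union_right

lemma upper_subset_cyl : upper ω ℓ g k ε ⊆ cyl ω ℓ := fun _ h => h.1

lemma lower_subset_cyl : lower ω ℓ g k ε ⊆ cyl ω ℓ := fun _ h => h.1

lemma IsAdmissible.restrict_cyl (H : IsAdmissible ω ℓ g k ε) :
    volume.restrict (cyl ω ℓ) = volume.restrict (cyl ω ℓ \ interface ω ℓ g k ε) :=
  Measure.restrict_congr_set (sdiff_null_ae_eq_self H.volume_interface).symm

lemma IsAdmissible.eLpNorm_sq_diff (H : IsAdmissible ω ℓ g k ε) {E : Type*}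
    [NormedAddCommGroup E] (f : Rn (n + 1) → E) :
    eLpNorm f 2 (volume.restrict (cyl ω ℓ \ interface ω ℓ g k ε)) ^ 2 =
      eLpNorm f 2 (volume.restrict (upper ω ℓ g k ε)) ^ 2 +
        eLpNorm f 2 (volume.restrict (lower ω ℓ g k ε)) ^ 2 := by
  simp only [eLpNorm_two_sq]
  rw [cyl_diff_interface, lintegral_union H.isOpen_lower.measurableSet disjoint_upper_lower]

lemma IsAdmissible.memLp_diff (H : IsAdmissible ω ℓ g k ε) {E : Type*}
    [NormedAddCommGroup E] {f : Rn (n + 1) → E}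
    (h1 : MemLp f 2 (volume.restrict (upper ω ℓ g k ε)))
    (h2 : MemLp f 2 (volume.restrict (lower ω ℓ g k ε))) :
    MemLp f 2 (volume.restrict (cyl ω ℓ \ interface ω ℓ g k ε)) := by
  refine ⟨?_, ?_⟩
  · rw [cyl_diff_interface, aestronglyMeasurable_union_iff]
    exact ⟨h1.1, h2.1⟩
  · refine (ENNReal.pow_lt_top_iff.1 (?_ : _ ^ 2 < ⊤)).resolve_right two_ne_zero
    rw [H.eLpNorm_sq_diff]
    have := h1.2
    have := h2.2
    finiteness

lemma ae_eq_diff_iff {E : Type*} {f f' : Rn (n + 1) → E} :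
    f =ᵐ[volume.restrict (cyl ω ℓ \ interface ω ℓ g k ε)] f' ↔
      f =ᵐ[volume.restrict (upper ω ℓ g k ε)] f' ∧
        f =ᵐ[volume.restrict (lower ω ℓ g k ε)] f' := by
  rw [cyl_diff_interface]
  exact ae_restrict_union_iff _ _ _

lemma IsAdmissible.grad_ae_eq_upper (H : IsAdmissible ω ℓ g k ε) (v : Rn (n + 1) → ℝ) :
    grad ω ℓ g k ε v =ᵐ[volume.restrict (upper ω ℓ g k ε)] weakGrad (upper ω ℓ g k ε) v := by
  filter_upwards [ae_restrict_mem H.isOpen_upper.measurableSet] with x hx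
  simp [grad, hx, Set.disjoint_left.1 disjoint_upper_lower hx]

lemma IsAdmissible.grad_ae_eq_lower (H : IsAdmissible ω ℓ g k ε) (v : Rn (n + 1) → ℝ) :
    grad ω ℓ g k ε v =ᵐ[volume.restrict (lower ω ℓ g k ε)] weakGrad (lower ω ℓ g k ε) v := by
  filter_upwards [ae_restrict_mem H.isOpen_lower.measurableSet] with x hx
  simp [grad, hx, Set.disjoint_right.1 disjoint_upper_lower hx]

namespace HasGradJump

variable {v w : Rn (n + 1) → ℝ} {F G : Rn (n + 1) → Rn (n + 1)} {J I : Rn (n + 1) → ℝ}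

lemma memLp_grad (H : IsAdmissible ω ℓ g k ε) (h : HasGradJump ω ℓ g k ε v F J) :
    MemLp F 2 (volume.restrict (cyl ω ℓ \ interface ω ℓ g k ε)) :=
  H.memLp_diff h.weak_upper.memLp_grad h.weak_lower.memLp_grad

lemma memLp_jump (h : HasGradJump ω ℓ g k ε v F J) :
    MemLp J 2 (surf (interface ω ℓ g k ε)) := by
  obtain ⟨T, U, hT, hU, hJ⟩ := h.exists_trace
  exact (hT.memLp_trace.sub hU.memLp_trace).ae_eq hJ.symm

lemma zero : HasGradJump ω ℓ g k ε 0 0 0 :=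
  ⟨.zero, .zero, .zero, .zero, 0, 0, .zero, .zero, by simp⟩

lemma add_smul (hv : HasGradJump ω ℓ g k ε v F J) (hw : HasGradJump ω ℓ g k ε w G I) (c : ℝ) :
    HasGradJump ω ℓ g k ε (v + c • w) (F + c • G) (J + c • I) where
  weak_upper := hv.weak_upper.add_smul hw.weak_upper c
  weak_lower := hv.weak_lower.add_smul hw.weak_lower c
  boundary_upper := by simpa using hv.boundary_upper.add_smul hw.boundary_upper c
  boundary_lower := by simpa using hv.boundary_lower.add_smul hw.boundary_lower c
  exists_trace := by
    obtain ⟨T, U, hT, hU, hJ⟩ := hv.exists_trace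
    obtain ⟨T', U', hT', hU', hI⟩ := hw.exists_trace
    refine ⟨_, _, hT.add_smul hT' c, hU.add_smul hU' c, ?_⟩
    filter_upwards [hJ, hI] with x h1 h2
    simp only [Pi.add_apply, Pi.sub_apply, Pi.smul_apply, smul_eq_mul] at *
    rw [h1, h2]; ring

lemma congr (h : HasGradJump ω ℓ g k ε v F J) (hv : v =ᵐ[volume.restrict (cyl ω ℓ)] w)
    (hF : F =ᵐ[volume.restrict (cyl ω ℓ \ interface ω ℓ g k ε)] G)
    (hJ : J =ᵐ[surf (interface ω ℓ g k ε)] I) : HasGradJump ω ℓ g k ε w G I := by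
  have v1 := ae_restrict_of_ae_restrict_of_subset (upper_subset_cyl (g := g) (k := k) (ε := ε)) hv
  have v2 := ae_restrict_of_ae_restrict_of_subset (lower_subset_cyl (g := g) (k := k) (ε := ε)) hv
  obtain ⟨F1, F2⟩ := ae_eq_diff_iff.1 hF
  obtain ⟨T, U, hT, hU, h3⟩ := h.exists_trace
  exact ⟨h.weak_upper.congr v1 F1, h.weak_lower.congr v2 F2, h.boundary_upper.congr v1 F1 .rfl,
    h.boundary_lower.congr v2 F2 .rfl, T, U, hT.congr v1 F1 .rfl, hU.congr v2 F2 .rfl,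
    hJ.symm.trans h3⟩

/-- `W0` only asks for traces on the outer boundary. The trace inequality shows that the same smooth
functions also converge on the interface, so `jump` is a difference of genuine traces and never the
default value 0 of `trace`. -/
lemma of_mem_W0 (H : IsAdmissible ω ℓ g k ε) {v : L2 ω ℓ} (hv : v ∈ W0 ω ℓ g k ε) :
    HasGradJump ω ℓ g k ε v (grad ω ℓ g k ε v) (jump ω ℓ g k ε v) := by
  obtain ⟨h1, h2, h3, h4⟩ := hv
  have F1 := (H.grad_ae_eq_upper v).symm
  have F2 := (H.grad_ae_eq_lower v).symm
  obtain ⟨C, hC, hS⟩ := H.exists_trace_upper_le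
  obtain ⟨C', hC', hS'⟩ := H.exists_trace_lower_le
  obtain ⟨T, hT⟩ := h3.smoothApprox.exists_trace hC hS
    fun φ hφ => H.memLp_interface hφ
  obtain ⟨U, hU⟩ := h4.smoothApprox.exists_trace hC' hS'
    fun φ hφ => H.memLp_interface hφ
  have eT := hT.ae_eq_trace hC H.isOpen_upper hS h1.isWeakGrad
  have eU := hU.ae_eq_trace hC' H.isOpen_lower hS' h2.isWeakGrad
  exact ⟨h1.isWeakGrad.congr .rfl F1, h2.isWeakGrad.congr .rfl F2,
    h3.smoothApprox.congr .rfl F1 .rfl, h4.smoothApprox.congr .rfl F2 .rfl, T, U,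
    hT.congr .rfl F1 .rfl, hU.congr .rfl F2 .rfl, (eT.sub eU).symm⟩

lemma mem_W0 (H : IsAdmissible ω ℓ g k ε) {v : L2 ω ℓ} (h : HasGradJump ω ℓ g k ε v F J) :
    v ∈ W0 ω ℓ g k ε :=
  ⟨⟨F, h.weak_upper⟩, ⟨F, h.weak_lower⟩, h.boundary_upper.isTrace H.isOpen_upper h.weak_upper,
    h.boundary_lower.isTrace H.isOpen_lower h.weak_lower⟩

lemma ae_eq_grad (H : IsAdmissible ω ℓ g k ε) (h : HasGradJump ω ℓ g k ε v F J) :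
    F =ᵐ[volume.restrict (cyl ω ℓ \ interface ω ℓ g k ε)] grad ω ℓ g k ε v :=
  ae_eq_diff_iff.2
    ⟨(h.weak_upper.ae_eq H.isOpen_upper (MemH1.isWeakGrad ⟨F, h.weak_upper⟩) .rfl).trans
      (H.grad_ae_eq_upper v).symm,
    (h.weak_lower.ae_eq H.isOpen_lower (MemH1.isWeakGrad ⟨F, h.weak_lower⟩) .rfl).trans
      (H.grad_ae_eq_lower v).symm⟩

lemma ae_eq_jump (H : IsAdmissible ω ℓ g k ε) (h : HasGradJump ω ℓ g k ε v F J) :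
    J =ᵐ[surf (interface ω ℓ g k ε)] jump ω ℓ g k ε v := by
  obtain ⟨C, hC, hS⟩ := H.exists_trace_upper_le
  obtain ⟨C', hC', hS'⟩ := H.exists_trace_lower_le
  obtain ⟨T, U, hT, hU, hJ⟩ := h.exists_trace
  exact hJ.trans ((hT.ae_eq_trace hC H.isOpen_upper hS h.weak_upper).sub
    (hU.ae_eq_trace hC' H.isOpen_lower hS' h.weak_lower))

/-- The Poincaré inequality, with a constant independent of the scale. -/
lemma eLpNorm_le (H : IsAdmissible ω ℓ g k ε) (h : HasGradJump ω ℓ g k ε v F J) :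
    eLpNorm v 2 (volume.restrict (cyl ω ℓ)) ≤
      poincareConst ℓ * eLpNorm F 2 (volume.restrict (cyl ω ℓ \ interface ω ℓ g k ε)) := by
  have h1 := h.boundary_upper.eLpNorm_le (poincareConst_ne_top ℓ) fun φ hφ => H.eLpNorm_upper_le hφ
  have h2 := h.boundary_lower.eLpNorm_le (poincareConst_ne_top ℓ) fun φ hφ => H.eLpNorm_lower_le hφ
  rw [eLpNorm_zero, zero_add] at h1 h2
  rw [← ENNReal.pow_le_pow_left_iff two_ne_zero, mul_pow, H.restrict_cyl, H.eLpNorm_sq_diff,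
    H.eLpNorm_sq_diff, mul_add, ← mul_pow, ← mul_pow]
  gcongr

/-- The jump depends continuously on the function and its gradient. -/
lemma exists_eLpNorm_jump_le (H : IsAdmissible ω ℓ g k ε) : ∃ C : ℝ≥0∞, C ≠ ⊤ ∧
    ∀ (v : Rn (n + 1) → ℝ) (F : Rn (n + 1) → Rn (n + 1)) (J : Rn (n + 1) → ℝ),
      HasGradJump ω ℓ g k ε v F J → eLpNorm J 2 (surf (interface ω ℓ g k ε)) ≤
        C * (eLpNorm v 2 (volume.restrict (cyl ω ℓ)) +
          eLpNorm F 2 (volume.restrict (cyl ω ℓ \ interface ω ℓ g k ε))) := by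
  obtain ⟨C, hC, hS⟩ := H.exists_trace_upper_le
  obtain ⟨C', hC', hS'⟩ := H.exists_trace_lower_le
  refine ⟨C + C', by finiteness, fun v F J h => ?_⟩
  obtain ⟨T, U, hT, hU, hJ⟩ := h.exists_trace
  rw [eLpNorm_congr_ae hJ, _root_.add_mul]
  refine (eLpNorm_sub_le hT.memLp_trace.1 hU.memLp_trace.1 (by norm_num)).trans (add_le_add ?_ ?_)
  · refine (hT.eLpNorm_trace_le hC hS).trans ?_
    gcongr
    · exact upper_subset_cyl
    · exact upper_subset_diff
  · refine (hU.eLpNorm_trace_le hC' hS').trans ?_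
    gcongr
    · exact lower_subset_cyl
    · exact lower_subset_diff

lemma of_tendsto (H : IsAdmissible ω ℓ g k ε) {vs Js : ℕ → Rn (n + 1) → ℝ}
    {Fs : ℕ → Rn (n + 1) → Rn (n + 1)} (h : ∀ j, HasGradJump ω ℓ g k ε (vs j) (Fs j) (Js j))
    (hv : MemLp v 2 (volume.restrict (cyl ω ℓ)))
    (hF : MemLp F 2 (volume.restrict (cyl ω ℓ \ interface ω ℓ g k ε)))
    (hJ : MemLp J 2 (surf (interface ω ℓ g k ε)))
    (tv : Tendsto (fun j => eLpNorm (vs j - v) 2 (volume.restrict (cyl ω ℓ))) atTop (𝓝 0))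
    (tF : Tendsto (fun j => eLpNorm (Fs j - F) 2
      (volume.restrict (cyl ω ℓ \ interface ω ℓ g k ε))) atTop (𝓝 0))
    (tJ : Tendsto (fun j => eLpNorm (Js j - J) 2 (surf (interface ω ℓ g k ε))) atTop (𝓝 0)) :
    HasGradJump ω ℓ g k ε v F J := by
  have mono : ∀ {E : Type} [NormedAddCommGroup E] {f : ℕ → Rn (n + 1) → E}
      {s t : Set (Rn (n + 1))}, s ⊆ t →
      Tendsto (fun j => eLpNorm (f j) 2 (volume.restrict t)) atTop (𝓝 0) →
      Tendsto (fun j => eLpNorm (f j) 2 (volume.restrict s)) atTop (𝓝 0) := fun hst ht =>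
    tendsto_of_tendsto_of_tendsto_of_le_of_le tendsto_const_nhds ht (fun _ => zero_le)
      fun j => eLpNorm_mono_measure _ (Measure.restrict_mono hst le_rfl)
  have v1 := hv.mono_measure (Measure.restrict_mono (upper_subset_cyl (g := g) (k := k) (ε := ε))
    le_rfl)
  have v2 := hv.mono_measure (Measure.restrict_mono (lower_subset_cyl (g := g) (k := k) (ε := ε))
    le_rfl)
  have F1 := hF.mono_measure (Measure.restrict_mono upper_subset_diff le_rfl)
  have F2 := hF.mono_measure (Measure.restrict_mono lower_subset_diff le_rfl)
  have tv1 := mono (upper_subset_cyl (g := g) (k := k) (ε := ε)) tv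
  have tv2 := mono (lower_subset_cyl (g := g) (k := k) (ε := ε)) tv
  have tF1 := mono upper_subset_diff tF
  have tF2 := mono lower_subset_diff tF
  have w1 := IsWeakGrad.of_tendsto (fun j => (h j).weak_upper) v1 F1 tv1 tF1
  have w2 := IsWeakGrad.of_tendsto (fun j => (h j).weak_lower) v2 F2 tv2 tF2
  have b1 := SmoothApprox.of_tendsto (fun j => (h j).boundary_upper) v1 F1 MemLp.zero tv1 tF1
    (by simp)
  have b2 := SmoothApprox.of_tendsto (fun j => (h j).boundary_lower) v2 F2 MemLp.zero tv2 tF2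
    (by simp)
  obtain ⟨C, hC, hS⟩ := H.exists_trace_upper_le
  obtain ⟨C', hC', hS'⟩ := H.exists_trace_lower_le
  -- Only the jumps are assumed to converge, so the one-sided traces of the limit are rebuilt from
  -- its own approximations and T − U is then identified with `J`.
  obtain ⟨T, hT⟩ := b1.exists_trace hC hS fun φ hφ => H.memLp_interface hφ
  obtain ⟨U, hU⟩ := b2.exists_trace hC' hS' fun φ hφ => H.memLp_interface hφ
  have h' : HasGradJump ω ℓ g k ε v F (T - U) := ⟨w1, w2, b1, b2, T, U, hT, hU, .rfl⟩
  obtain ⟨D, hD, hDle⟩ := exists_eLpNorm_jump_le H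
  have tJ' : Tendsto (fun j => eLpNorm (Js j - (T - U)) 2 (surf (interface ω ℓ g k ε)))
      atTop (𝓝 0) := by
    refine tendsto_of_tendsto_of_tendsto_of_le_of_le tendsto_const_nhds
      (by simpa using ENNReal.Tendsto.const_mul (tv.add tF) (.inr hD)) (fun _ => zero_le) fun j => ?_
    simpa only [neg_smul, one_smul, ← sub_eq_add_neg] using hDle _ _ _ ((h j).add_smul h' (-1))
  refine h'.congr .rfl .rfl ?_
  have hz : eLpNorm ((T - U) - J) 2 (surf (interface ω ℓ g k ε)) = 0 := by
    refine le_antisymm (ge_of_tendsto' (by simpa using tJ'.add tJ) fun j => ?_) zero_le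
    rw [eLpNorm_sub_comm (Js j) (T - U)]
    have : T - U - J = (T - U - Js j) + (Js j - J) := by abel
    rw [this]
    exact eLpNorm_add_le (h'.memLp_jump.1.sub (h j).memLp_jump.1)
      ((h j).memLp_jump.1.sub hJ.1) (by norm_num)
  have hz' := (eLpNorm_eq_zero_iff (h'.memLp_jump.1.sub hJ.1) two_ne_zero).1 hz
  filter_upwards [hz'] with x hx
  exact sub_eq_zero.1 hx

end HasGradJump

end Domain

/-! ### An abstract obstacle problem in a product Hilbert space -/

section Product

lemma norm_sq_eq_triple {E₁ E₂ E₃ : Type*} [NormedAddCommGroup E₁] [NormedAddCommGroup E₂]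
    [NormedAddCommGroup E₃] (z : WithLp 2 (E₁ × WithLp 2 (E₂ × E₃))) :
    ‖z‖ ^ 2 = ‖z.fst‖ ^ 2 + (‖z.snd.fst‖ ^ 2 + ‖z.snd.snd‖ ^ 2) := by
  rw [WithLp.prod_norm_sq_eq_of_L2, WithLp.prod_norm_sq_eq_of_L2]

variable {E₁ E₂ E₃ : Type*} [NormedAddCommGroup E₁] [InnerProductSpace ℝ E₁]
  [NormedAddCommGroup E₂] [InnerProductSpace ℝ E₂] [NormedAddCommGroup E₃]
  [InnerProductSpace ℝ E₃]

/-- The diagonal operator on a product of Hilbert spaces. -/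
def diagOperator (S : E₁ →L[ℝ] E₁) (T : E₂ →L[ℝ] E₂) :
    WithLp 2 (E₁ × E₂) →L[ℝ] WithLp 2 (E₁ × E₂) :=
  ((WithLp.prodContinuousLinearEquiv 2 ℝ E₁ E₂).symm : E₁ × E₂ →L[ℝ] WithLp 2 (E₁ × E₂)) ∘L
    (S.prodMap T) ∘L
    ((WithLp.prodContinuousLinearEquiv 2 ℝ E₁ E₂) : WithLp 2 (E₁ × E₂) →L[ℝ] E₁ × E₂)

lemma inner_diagOperator (S : E₁ →L[ℝ] E₁) (T : E₂ →L[ℝ] E₂) (z w : WithLp 2 (E₁ × E₂)) :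
    inner ℝ (diagOperator S T z) w = inner ℝ (S z.fst) w.fst + inner ℝ (T z.snd) w.snd := by
  rw [WithLp.prod_inner_apply]; rfl

lemma inner_toLp_zero (f : E₁) (w : WithLp 2 (E₁ × E₂)) :
    inner ℝ (WithLp.toLp 2 (f, (0 : E₂))) w = inner ℝ f w.fst := by
  rw [WithLp.prod_inner_apply]
  change inner ℝ f w.fst + inner ℝ (0 : E₂) w.snd = _
  rw [inner_zero_left, add_zero]

/-- The operator built from operators acting on the last two components of a triple. -/
def energyOperator (MA : E₂ →L[ℝ] E₂) (Mh : E₃ →L[ℝ] E₃) (κ : ℝ) :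
    WithLp 2 (E₁ × WithLp 2 (E₂ × E₃)) →L[ℝ] WithLp 2 (E₁ × WithLp 2 (E₂ × E₃)) :=
  diagOperator 0 (diagOperator MA (κ • Mh))

lemma inner_energyOperator (MA : E₂ →L[ℝ] E₂) (Mh : E₃ →L[ℝ] E₃) (κ : ℝ)
    (z w : WithLp 2 (E₁ × WithLp 2 (E₂ × E₃))) :
    inner ℝ (energyOperator MA Mh κ z) w =
      inner ℝ (MA z.snd.fst) w.snd.fst + κ * inner ℝ (Mh z.snd.snd) w.snd.snd := by
  rw [energyOperator, inner_diagOperator, inner_diagOperator, _root_.zero_apply,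
    inner_zero_left, zero_add, _root_.smul_apply, real_inner_smul_left]

/-- The operator ignores the first component, so it is coercive only where `hG` controls that
component by the second, that is on G; this suffices because differences of elements of S stay in G.
-/
lemma exists_unique_obstacle [CompleteSpace E₁] [CompleteSpace E₂] [CompleteSpace E₃]
    {G : Submodule ℝ (WithLp 2 (E₁ × WithLp 2 (E₂ × E₃)))}
    {S : Set (WithLp 2 (E₁ × WithLp 2 (E₂ × E₃)))} (hSG : S ⊆ G) (h0 : 0 ∈ S)
    (hcl : IsClosed S) (hconv : Convex ℝ S) {D : ℝ} (hD : 0 ≤ D)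
    (hG : ∀ z ∈ G, ‖z.fst‖ ≤ D * ‖z.snd.fst‖) (MA : E₂ →L[ℝ] E₂) (Mh : E₃ →L[ℝ] E₃)
    {α h₀ κ : ℝ} (hα : 0 < α) (hh₀ : 0 < h₀) (hκ : 0 < κ)
    (cA : ∀ F, α * ‖F‖ ^ 2 ≤ inner ℝ (MA F) F) (ch : ∀ J, h₀ * ‖J‖ ^ 2 ≤ inner ℝ (Mh J) J)
    (f : E₁) :
    ∃ z ∈ S, (∀ w ∈ S, inner ℝ (WithLp.toLp 2 (f, (0 : WithLp 2 (E₂ × E₃)))) (w - z) ≤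
        inner ℝ (energyOperator MA Mh κ z) (w - z)) ∧
      (∀ y ∈ S, (∀ w ∈ S, inner ℝ (WithLp.toLp 2 (f, (0 : WithLp 2 (E₂ × E₃)))) (w - y) ≤
        inner ℝ (energyOperator MA Mh κ y) (w - y)) → y = z) ∧
      ‖z.snd.fst‖ ≤ D * ‖f‖ / α ∧ ‖z.snd.snd‖ ^ 2 ≤ α / h₀ * (D * ‖f‖ / α) ^ 2 / κ := by
  set B : WithLp 2 (E₁ × WithLp 2 (E₂ × E₃)) →L[ℝ] WithLp 2 (E₁ × WithLp 2 (E₂ × E₃)) :=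
    energyOperator MA Mh κ
  -- On G, ‖z‖² ≤ (1 + D²)‖z.snd.fst‖² + ‖z.snd.snd‖². This constant depends on κ and serves only
  -- for existence and uniqueness; the bounds use `coer'` directly.
  set c := min (α / (1 + D ^ 2)) (κ * h₀)
  have hc : 0 < c := by positivity
  have coer' : ∀ z : WithLp 2 (E₁ × WithLp 2 (E₂ × E₃)), α * ‖z.snd.fst‖ ^ 2 +
      κ * h₀ * ‖z.snd.snd‖ ^ 2 ≤ inner ℝ (B z) z := fun z => by
    rw [inner_energyOperator, mul_assoc]
    have := cA z.snd.fst
    have := mul_le_mul_of_nonneg_left (ch z.snd.snd) hκ.le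
    linarith
  have coer : ∀ z ∈ G, c * ‖z‖ ^ 2 ≤ inner ℝ (B z) z := fun z hz => by
    refine le_trans ?_ (coer' z)
    have h1 : ‖z.fst‖ ^ 2 ≤ D ^ 2 * ‖z.snd.fst‖ ^ 2 := by
      rw [← mul_pow]; gcongr; exact hG z hz
    have h2 : c * ((1 + D ^ 2) * ‖z.snd.fst‖ ^ 2) ≤ α * ‖z.snd.fst‖ ^ 2 := by
      have : c * (1 + D ^ 2) ≤ α := (le_div_iff₀ (by positivity)).1 (min_le_left _ _)
      rw [← mul_assoc]; gcongr
    have h3 : c * ‖z.snd.snd‖ ^ 2 ≤ κ * h₀ * ‖z.snd.snd‖ ^ 2 := by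
      gcongr; exact min_le_right _ _
    rw [norm_sq_eq_triple]
    nlinarith [mul_le_mul_of_nonneg_left h1 hc.le]
  set f' : WithLp 2 (E₁ × WithLp 2 (E₂ × E₃)) := WithLp.toLp 2 (f, 0)
  obtain ⟨z, hz, hsol⟩ := exists_variational_inequality ⟨0, h0⟩
    hcl hconv B hc
    (fun u hu v hv => coer _ (Submodule.sub_mem _ (hSG hu) (hSG hv))) f'
  refine ⟨z, hz, hsol, fun y hy hsol' => ?_, ?_⟩
  · have e1 := hsol y hy
    have e2 := hsol' z hz
    have e3 := coer (y - z) (Submodule.sub_mem _ (hSG hy) (hSG hz))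
    have e4 : inner ℝ (B (y - z)) (y - z) = -inner ℝ (B y) (z - y) - inner ℝ (B z) (y - z) := by
      simp only [map_sub, inner_sub_left, inner_sub_right]; ring
    have e5 : inner ℝ f' (z - y) = -inner ℝ f' (y - z) := by
      rw [← inner_neg_right, neg_sub]
    have e6 : c * ‖y - z‖ ^ 2 ≤ 0 := by
      refine e3.trans ?_
      change inner ℝ f' (z - y) ≤ inner ℝ (B y) (z - y) at e2
      linarith
    have e7 : ‖y - z‖ = 0 := by
      have : ‖y - z‖ ^ 2 ≤ 0 := by
        by_contra! hpos
        exact absurd e6 (not_le.2 (mul_pos hc hpos))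
      exact pow_eq_zero_iff two_ne_zero |>.1 (le_antisymm this (sq_nonneg _))
    exact sub_eq_zero.1 (norm_eq_zero.1 e7)
  · set a := ‖z.snd.fst‖
    set b := ‖z.snd.snd‖
    have ha : 0 ≤ a := norm_nonneg _
    have hb : 0 ≤ b := norm_nonneg _
    -- The energy estimate, from the test element 0. Dropping the b term bounds a; inserting that
    -- bound on the right then bounds b.
    have key : α * a ^ 2 + κ * h₀ * b ^ 2 ≤ D * ‖f‖ * a := by
      have e1 := hsol 0 h0
      rw [zero_sub, inner_neg_right, inner_neg_right, neg_le_neg_iff] at e1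
      have e2 : inner ℝ f' z ≤ ‖f‖ * ‖z.fst‖ := by
        rw [inner_toLp_zero]; exact real_inner_le_norm _ _
      have e3 : ‖f‖ * ‖z.fst‖ ≤ ‖f‖ * (D * a) := by gcongr; exact hG z (hSG hz)
      linarith [coer' z]
    have ha' : a ≤ D * ‖f‖ / α := by
      rw [le_div_iff₀ hα]
      by_contra! hlt
      have hapos : 0 < a := by
        by_contra! ha0
        have : a = 0 := le_antisymm ha0 ha
        rw [this, zero_mul] at hlt
        exact absurd hlt (not_lt.2 (by positivity))
      have : 0 ≤ κ * h₀ * b ^ 2 := by positivity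
      nlinarith
    have e2 : κ * h₀ * b ^ 2 ≤ D * ‖f‖ * (D * ‖f‖ / α) := by
      have h1 : D * ‖f‖ * a ≤ D * ‖f‖ * (D * ‖f‖ / α) := by gcongr
      have h2 : 0 ≤ α * a ^ 2 := by positivity
      linarith
    have e3 : α / h₀ * (D * ‖f‖ / α) ^ 2 = D * ‖f‖ * (D * ‖f‖ / α) / h₀ := by
      field_simp
    refine ⟨ha', ?_⟩
    rw [le_div_iff₀ hκ, e3, le_div_iff₀ hh₀]
    linarith

end Product

/-! ### The energy space -/

section Energy

variable {n : ℕ}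

/-- The Hilbert space of triples (function, gradient, jump). -/
abbrev EnergySpace (ω : Set (Rn n)) (ℓ : ℝ) (g : Rn n → ℝ) (k ε : ℝ) : Type :=
  WithLp 2 (L2 ω ℓ × WithLp 2
    (Lp (Rn (n + 1)) 2 (volume.restrict (cyl ω ℓ \ interface ω ℓ g k ε)) ×
      Lp ℝ 2 (surf (interface ω ℓ g k ε))))

/-- The subspace of triples consisting of a function, its gradient and its jump. -/
def graphSpace (ω : Set (Rn n)) (ℓ : ℝ) (g : Rn n → ℝ) (k ε : ℝ) :
    Submodule ℝ (EnergySpace ω ℓ g k ε) where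
  carrier := {z | HasGradJump ω ℓ g k ε z.fst z.snd.fst z.snd.snd}
  zero_mem' := HasGradJump.zero.congr (Lp.coeFn_zero _ _ _).symm (Lp.coeFn_zero _ _ _).symm
    (Lp.coeFn_zero _ _ _).symm
  add_mem' := fun {z w} hz hw => by
    have h := HasGradJump.add_smul hz hw 1
    simp only [one_smul] at h
    exact h.congr (Lp.coeFn_add _ _).symm (Lp.coeFn_add _ _).symm (Lp.coeFn_add _ _).symm
  smul_mem' := fun c z hz => by
    have h := HasGradJump.zero.add_smul hz c
    simp only [zero_add] at h
    exact h.congr (Lp.coeFn_smul _ _).symm (Lp.coeFn_smul _ _).symm (Lp.coeFn_smul _ _).symm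

/-- The convex set of triples with nonnegative jump. -/
def graphCone (ω : Set (Rn n)) (ℓ : ℝ) (g : Rn n → ℝ) (k ε : ℝ) :
    Set (EnergySpace ω ℓ g k ε) :=
  {z | z ∈ graphSpace ω ℓ g k ε ∧ (0 : Lp ℝ 2 (surf (interface ω ℓ g k ε))) ≤ z.snd.snd}

variable {ω : Set (Rn n)} {ℓ : ℝ} {g : Rn n → ℝ} {k ε : ℝ}

lemma hasGradJump_of_mem {z : EnergySpace ω ℓ g k ε} (hz : z ∈ graphSpace ω ℓ g k ε) :
    HasGradJump ω ℓ g k ε z.fst z.snd.fst z.snd.snd := hz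

lemma isClosed_graphSpace (H : IsAdmissible ω ℓ g k ε) :
    IsClosed (graphSpace ω ℓ g k ε : Set (EnergySpace ω ℓ g k ε)) := by
  refine IsSeqClosed.isClosed fun zs z hzs hz => ?_
  have t1 := ((WithLp.continuous_fst 2 _ _).tendsto z).comp hz
  have t2 := ((WithLp.continuous_snd 2 _ _).tendsto z).comp hz
  have t3 := ((WithLp.continuous_fst 2 _ _).tendsto z.snd).comp t2
  have t4 := ((WithLp.continuous_snd 2 _ _).tendsto z.snd).comp t2
  rw [Lp.tendsto_Lp_iff_tendsto_eLpNorm'] at t1 t3 t4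
  exact HasGradJump.of_tendsto H hzs (Lp.memLp _) (Lp.memLp _) (Lp.memLp _) t1 t3 t4

lemma continuous_snd_snd :
    Continuous fun z : EnergySpace ω ℓ g k ε => z.snd.snd :=
  (WithLp.continuous_snd 2 _ _).comp (WithLp.continuous_snd 2 _ _)

lemma isClosed_graphCone (H : IsAdmissible ω ℓ g k ε) : IsClosed (graphCone ω ℓ g k ε) := by
  have h : IsClosed {z : EnergySpace ω ℓ g k ε |
      (0 : Lp ℝ 2 (surf (interface ω ℓ g k ε))) ≤ z.snd.snd} :=
    isClosed_le continuous_const continuous_snd_snd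
  exact (isClosed_graphSpace H).inter h

lemma Lp_smul_nonneg {X : Type*} [MeasurableSpace X] {μ : Measure X} {a : ℝ} (ha : 0 ≤ a)
    {J : Lp ℝ 2 μ} (hJ : 0 ≤ J) : 0 ≤ a • J := by
  refine (Lp.coeFn_nonneg _).1 ?_
  filter_upwards [(Lp.coeFn_nonneg _).2 hJ, Lp.coeFn_smul a J] with x h1 h2
  rw [h2]
  exact mul_nonneg ha h1

lemma real_inner_eq_mul (a b : ℝ) : inner ℝ a b = a * b := by
  rw [RCLike.inner_apply, conj_trivial, mul_comm]

lemma convex_graphCone : Convex ℝ (graphCone ω ℓ g k ε) := by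
  rintro z ⟨hz, hz'⟩ w ⟨hw, hw'⟩ a b ha hb -
  exact ⟨Submodule.add_mem _ (Submodule.smul_mem _ _ hz) (Submodule.smul_mem _ _ hw),
    add_nonneg (Lp_smul_nonneg ha hz') (Lp_smul_nonneg hb hw')⟩

lemma zero_mem_graphCone : 0 ∈ graphCone ω ℓ g k ε := ⟨Submodule.zero_mem _, le_rfl⟩

lemma ae_eq_grad_of_mem (H : IsAdmissible ω ℓ g k ε) {z : EnergySpace ω ℓ g k ε}
    (hz : z ∈ graphCone ω ℓ g k ε) :
    z.snd.fst =ᵐ[volume.restrict (cyl ω ℓ \ interface ω ℓ g k ε)] grad ω ℓ g k ε z.fst :=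
  (hasGradJump_of_mem hz.1).ae_eq_grad H

lemma ae_eq_jump_of_mem (H : IsAdmissible ω ℓ g k ε) {z : EnergySpace ω ℓ g k ε}
    (hz : z ∈ graphCone ω ℓ g k ε) :
    z.snd.snd =ᵐ[surf (interface ω ℓ g k ε)] jump ω ℓ g k ε z.fst :=
  (hasGradJump_of_mem hz.1).ae_eq_jump H

lemma fst_mem_K (H : IsAdmissible ω ℓ g k ε) {z : EnergySpace ω ℓ g k ε}
    (hz : z ∈ graphCone ω ℓ g k ε) : z.fst ∈ K ω ℓ g k ε := by
  refine ⟨(hasGradJump_of_mem hz.1).mem_W0 H, ?_⟩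
  filter_upwards [ae_eq_jump_of_mem H hz, (Lp.coeFn_nonneg _).2 hz.2] with x h1 h2
  rw [← h1]; exact h2

/-- With `fst_mem_K`, this makes the first projection a surjection from the cone onto `K`, so
solutions and test functions can be moved between the two settings. -/
lemma exists_fst_eq (H : IsAdmissible ω ℓ g k ε) {v : L2 ω ℓ} (hv : v ∈ K ω ℓ g k ε) :
    ∃ z ∈ graphCone ω ℓ g k ε, z.fst = v := by
  have h := HasGradJump.of_mem_W0 H hv.1
  have hF := h.memLp_grad H
  have hJ := h.memLp_jump
  refine ⟨WithLp.toLp 2 (v, WithLp.toLp 2 (hF.toLp _, hJ.toLp _)), ⟨?_, ?_⟩, rfl⟩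
  · exact h.congr .rfl hF.coeFn_toLp.symm hJ.coeFn_toLp.symm
  · refine (Lp.coeFn_nonneg _).1 ?_
    filter_upwards [hv.2, hJ.coeFn_toLp] with x h1 h2
    exact h1.trans_eq h2.symm

lemma norm_fst_le (H : IsAdmissible ω ℓ g k ε) {z : EnergySpace ω ℓ g k ε}
    (hz : z ∈ graphSpace ω ℓ g k ε) : ‖z.fst‖ ≤ (poincareConst ℓ).toReal * ‖z.snd.fst‖ := by
  have h := (hasGradJump_of_mem hz).eLpNorm_le H
  rw [Lp.norm_def, Lp.norm_def, ← ENNReal.toReal_mul]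
  exact ENNReal.toReal_mono (ENNReal.mul_ne_top (poincareConst_ne_top ℓ) (Lp.eLpNorm_ne_top _)) h

lemma inner_sub_eq_integral {X E : Type*} [MeasurableSpace X] {μ : Measure X}
    [NormedAddCommGroup E] [InnerProductSpace ℝ E] {G F F' : Lp E 2 μ} {p q r : X → E}
    (hG : G =ᵐ[μ] p) (hF : F =ᵐ[μ] q) (hF' : F' =ᵐ[μ] r) :
    inner ℝ G (F - F') = ∫ x, inner ℝ (p x) (q x - r x) ∂μ := by
  rw [L2.inner_def]
  refine integral_congr_ae ?_
  filter_upwards [Lp.coeFn_sub F F', hG, hF, hF'] with x h1 h2 h3 h4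
  rw [h1, Pi.sub_apply, h2, h3, h4]

/-- On the cone the second and third components agree almost everywhere with `grad` and `jump` of
the first, so the Hilbert space pairings are the integrals of the weak formulation. -/
lemma isWeakSolution_fst_iff (H : IsAdmissible ω ℓ g k ε) {γ : ℝ}
    {A : Rn (n + 1) → Matrix (Fin (n + 1)) (Fin (n + 1)) ℝ} {h : Rn n → ℝ} {f : L2 ω ℓ}
    {MA : Lp (Rn (n + 1)) 2 (volume.restrict (cyl ω ℓ \ interface ω ℓ g k ε)) →L[ℝ]
      Lp (Rn (n + 1)) 2 (volume.restrict (cyl ω ℓ \ interface ω ℓ g k ε))}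
    {Mh : Lp ℝ 2 (surf (interface ω ℓ g k ε)) →L[ℝ] Lp ℝ 2 (surf (interface ω ℓ g k ε))}
    (hMA : ∀ F, MA F =ᵐ[volume.restrict (cyl ω ℓ \ interface ω ℓ g k ε)]
      fun x => (A (ε⁻¹ • x)).toEuclideanLin (F x))
    (hMh : ∀ J, Mh J =ᵐ[surf (interface ω ℓ g k ε)] fun x => h (ε⁻¹ • horiz x) * J x)
    {z : EnergySpace ω ℓ g k ε} (hz : z ∈ graphCone ω ℓ g k ε) :
    IsWeakSolution ω ℓ g k γ A h f ε z.fst ↔ ∀ w ∈ graphCone ω ℓ g k ε,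
      inner ℝ (WithLp.toLp 2 (f, 0) : EnergySpace ω ℓ g k ε) (w - z) ≤
        inner ℝ (energyOperator MA Mh (ε ^ γ) z) (w - z) := by
  have key : ∀ w ∈ graphCone ω ℓ g k ε,
      (inner ℝ (WithLp.toLp 2 (f, 0) : EnergySpace ω ℓ g k ε) (w - z) =
        ∫ x in cyl ω ℓ, f x * (w.fst x - z.fst x)) ∧
      inner ℝ (energyOperator MA Mh (ε ^ γ) z) (w - z) =
      (∫ x in cyl ω ℓ \ interface ω ℓ g k ε,
        inner ℝ ((A (ε⁻¹ • x)).toEuclideanLin (grad ω ℓ g k ε z.fst x))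
          (grad ω ℓ g k ε w.fst x - grad ω ℓ g k ε z.fst x)) +
      ε ^ γ * ∫ x, h (ε⁻¹ • horiz x) * jump ω ℓ g k ε z.fst x *
        (jump ω ℓ g k ε w.fst x - jump ω ℓ g k ε z.fst x) ∂(surf (interface ω ℓ g k ε)) := by
    intro w hw
    rw [inner_toLp_zero, inner_energyOperator]
    have e1 := inner_sub_eq_integral (EventuallyEq.rfl (f := (f : Rn (n + 1) → ℝ)))
      (EventuallyEq.rfl (f := (w.fst : Rn (n + 1) → ℝ)))
      (EventuallyEq.rfl (f := (z.fst : Rn (n + 1) → ℝ)))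
    have hz2 := ae_eq_grad_of_mem H hz
    have hz3 := ae_eq_jump_of_mem H hz
    have e2 := inner_sub_eq_integral ((hMA z.snd.fst).trans
      (hz2.mono fun x hx => congrArg (A (ε⁻¹ • x)).toEuclideanLin hx))
      (ae_eq_grad_of_mem H hw) hz2
    have e3 := inner_sub_eq_integral ((hMh z.snd.snd).trans
      (hz3.mono fun x hx => congrArg (h (ε⁻¹ • horiz x) * ·) hx)) (ae_eq_jump_of_mem H hw) hz3
    simp only [real_inner_eq_mul] at e1 e3
    exact ⟨e1, congrArg₂ (· + ε ^ γ * ·) e2 e3⟩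
  constructor
  · intro hs w hw
    rw [(key w hw).1, (key w hw).2]
    exact hs.ineq _ (fst_mem_K H hw)
  · refine fun hs => ⟨fst_mem_K H hz, fun v hv => ?_⟩
    obtain ⟨w, hw, rfl⟩ := exists_fst_eq H hv
    rw [← (key w hw).1, ← (key w hw).2]
    exact hs w hw

/-- Existence, uniqueness and energy bounds at a fixed scale, given the coefficient operators. -/
lemma exists_isWeakSolution (H : IsAdmissible ω ℓ g k ε) (hε : 0 < ε) {γ : ℝ}
    {A : Rn (n + 1) → Matrix (Fin (n + 1)) (Fin (n + 1)) ℝ} {h : Rn n → ℝ} (f : L2 ω ℓ)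
    {MA : Lp (Rn (n + 1)) 2 (volume.restrict (cyl ω ℓ \ interface ω ℓ g k ε)) →L[ℝ]
      Lp (Rn (n + 1)) 2 (volume.restrict (cyl ω ℓ \ interface ω ℓ g k ε))}
    {Mh : Lp ℝ 2 (surf (interface ω ℓ g k ε)) →L[ℝ] Lp ℝ 2 (surf (interface ω ℓ g k ε))}
    (hMA : ∀ F, MA F =ᵐ[volume.restrict (cyl ω ℓ \ interface ω ℓ g k ε)]
      fun x => (A (ε⁻¹ • x)).toEuclideanLin (F x))
    (hMh : ∀ J, Mh J =ᵐ[surf (interface ω ℓ g k ε)] fun x => h (ε⁻¹ • horiz x) * J x)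
    {α h₀ : ℝ} (hα : 0 < α) (hh₀ : 0 < h₀) (cA : ∀ F, α * ‖F‖ ^ 2 ≤ inner ℝ (MA F) F)
    (ch : ∀ J, h₀ * ‖J‖ ^ 2 ≤ inner ℝ (Mh J) J) :
    ∃ u : L2 ω ℓ, IsWeakSolution ω ℓ g k γ A h f ε u ∧
      (∀ w : L2 ω ℓ, IsWeakSolution ω ℓ g k γ A h f ε w → w = u) ∧
      eLpNorm (grad ω ℓ g k ε u) 2 (volume.restrict (cyl ω ℓ \ interface ω ℓ g k ε)) ≤
        ENNReal.ofReal ((poincareConst ℓ).toReal * ‖f‖ / α) ∧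
      eLpNorm (jump ω ℓ g k ε u) 2 (surf (interface ω ℓ g k ε)) ≤
        ENNReal.ofReal (√(α / h₀) * ((poincareConst ℓ).toReal * ‖f‖ / α) * ε ^ (-γ / 2)) := by
  have hκ : 0 < ε ^ γ := Real.rpow_pos_of_pos hε γ
  obtain ⟨z, hz, hsol, huniq, ha, hb⟩ := exists_unique_obstacle (fun z hz => hz.1)
    zero_mem_graphCone (isClosed_graphCone H) convex_graphCone ENNReal.toReal_nonneg
    (fun z hz => norm_fst_le H hz) MA Mh hα hh₀ hκ cA ch f
  refine ⟨z.fst, (isWeakSolution_fst_iff H hMA hMh hz).2 hsol, fun w hw => ?_, ?_, ?_⟩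
  · obtain ⟨y, hy, rfl⟩ := exists_fst_eq H hw.mem
    rw [huniq y hy ((isWeakSolution_fst_iff H hMA hMh hy).1 hw)]
  · rw [← eLpNorm_congr_ae (ae_eq_grad_of_mem H hz), ← Lp.enorm_def, ← ofReal_norm]
    exact ENNReal.ofReal_le_ofReal ha
  · rw [← eLpNorm_congr_ae (ae_eq_jump_of_mem H hz), ← Lp.enorm_def, ← ofReal_norm]
    refine ENNReal.ofReal_le_ofReal (le_of_sq_le_sq (hb.trans_eq ?_) ?_)
    · have e1 : (ε ^ (-γ / 2)) ^ 2 = (ε ^ γ)⁻¹ := by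
        rw [← Real.rpow_natCast, ← Real.rpow_mul hε.le, ← Real.rpow_neg hε.le]
        norm_num
      rw [mul_pow, mul_pow, e1, Real.sq_sqrt (by positivity), ← div_eq_mul_inv]
    · have : 0 ≤ (poincareConst ℓ).toReal := ENNReal.toReal_nonneg
      positivity

lemma aestronglyMeasurable_toEuclideanLin {X : Type*} [MeasurableSpace X] {μ : Measure X} {d : ℕ}
    {A : X → Matrix (Fin d) (Fin d) ℝ} (hA : ∀ i j, AEMeasurable (fun x => A x i j) μ)
    {F : X → Rn d} (hF : AEStronglyMeasurable F μ) :
    AEStronglyMeasurable (fun x => (A x).toEuclideanLin (F x)) μ := by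
  refine ((PiLp.continuous_toLp 2 _).measurable.comp_aemeasurable
    (aemeasurable_pi_iff.2 fun i => ?_)).aestronglyMeasurable
  have hj : ∀ j, AEMeasurable (fun x => F x j) μ := fun j =>
    (show Continuous fun y : Rn d => y j by fun_prop).measurable.comp_aemeasurable hF.aemeasurable
  change AEMeasurable (fun x => ∑ j, A x i j * F x j) μ
  exact Finset.aemeasurable_fun_sum _ fun j _ => (hA i j).mul (hj j)

lemma le_inner_of_ae {X E : Type*} [MeasurableSpace X] {μ : Measure X} [NormedAddCommGroup E]
    [InnerProductSpace ℝ E] {c : ℝ} {F G : Lp E 2 μ}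
    (h : ∀ᵐ x ∂μ, c * ‖F x‖ ^ 2 ≤ inner ℝ (G x) (F x)) : c * ‖F‖ ^ 2 ≤ inner ℝ G F := by
  rw [← real_inner_self_eq_norm_sq, L2.inner_def, L2.inner_def, ← integral_const_mul]
  refine integral_mono_ae ((L2.integrable_inner F F).const_mul c) (L2.integrable_inner G F) ?_
  filter_upwards [h] with x hx
  simpa only [real_inner_self_eq_norm_sq] using hx

end Energy

end

end Signorini

/-! ### Rescaled coefficients and estimates uniform in the scale. -/

theorem theorem3p2 (n : ℕ) (hn : 1 ≤ n)
    (ω : Set (Rn n)) (hω : IsBoundedSmoothDomain ω) (ℓ : ℝ) (hℓ : 0 < ℓ)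
    (k : ℝ) (hk : 0 < k) (γ : ℝ)
    (g : Rn n → ℝ) (g_pos : ∀ y, 0 < g y)
    (g_per : ∀ (i : Fin n) (y : Rn n), g (y + EuclideanSpace.single i 1) = g y)
    (g_lip : ∃ L, LipschitzWith L g)
    (A : Rn (n + 1) → Matrix (Fin (n + 1)) (Fin (n + 1)) ℝ)
    (A_meas : ∀ i j, AEMeasurable (fun y => A y i j) volume)
    (A_per : IsAEPeriodic A) (α β : ℝ) (hα : 0 < α) (hαβ : α < β)
    (A_ell : ∀ᵐ y ∂(volume.restrict (unitCell (n + 1))), ∀ ξ : Rn (n + 1),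
      α * ‖ξ‖ ^ 2 ≤ inner ℝ ((A y).toEuclideanLin ξ) ξ ∧ ‖(A y).toEuclideanLin ξ‖ ≤ β * ‖ξ‖)
    (h : Rn n → ℝ) (h_mem : MemLp h ∞ volume) (h_per : IsAEPeriodic h)
    (h₀ : ℝ) (h₀_pos : 0 < h₀) (h_lower : ∀ᵐ y ∂(volume.restrict (unitCell n)), h₀ < h y)
    (f : L2 ω ℓ) :
    ∃ C : ℝ, 0 < C ∧ ∀ ε : ℝ, 0 < ε → (∀ x' ∈ closure ω, height g k ε x' < ℓ) →
      ∃ u : L2 ω ℓ,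
        IsWeakSolution ω ℓ g k γ A h f ε u ∧
        (∀ w : L2 ω ℓ, IsWeakSolution ω ℓ g k γ A h f ε w → w = u) ∧
        eLpNorm (grad ω ℓ g k ε u) 2
          (volume.restrict (cyl ω ℓ \ interface ω ℓ g k ε)) ≤ ENNReal.ofReal C ∧
        eLpNorm (jump ω ℓ g k ε u) 2 (surf (interface ω ℓ g k ε)) ≤
          ENNReal.ofReal (C * ε ^ (-γ / 2)) := by
  have hA_all : ∀ᵐ y : Rn (n + 1), ∀ ξ : Rn (n + 1), α * ‖ξ‖ ^ 2 ≤
      inner ℝ ((A y).toEuclideanLin ξ) ξ ∧ ‖(A y).toEuclideanLin ξ‖ ≤ β * ‖ξ‖ :=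
    ae_of_ae_unitCell (fun i => (A_per i).mono fun y hy => by rw [hy]) A_ell
  have hh_all : ∀ᵐ y : Rn n, h₀ < h y :=
    ae_of_ae_unitCell (fun i => (h_per i).mono fun y hy => by rw [hy]) h_lower
  obtain ⟨β', hβ'⟩ : ∃ β' : ℝ, ∀ᵐ y : Rn n, ‖h y‖ ≤ β' :=
    ⟨_, ae_le_lpNorm_exponent_top h_mem⟩
  set D := (poincareConst ℓ).toReal * ‖f‖ / α
  have hD : 0 ≤ D := div_nonneg (mul_nonneg ENNReal.toReal_nonneg (norm_nonneg f)) hα.le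
  have hs : 0 ≤ √(α / h₀) := Real.sqrt_nonneg _
  -- D depends on ℓ, f and α only. One constant dominates both bounds, and the added 1 keeps it
  -- positive when f = 0.
  refine ⟨D + √(α / h₀) * D + 1, by positivity, fun ε hε hlt => ?_⟩
  have H : IsAdmissible ω ℓ g k ε := hω.isAdmissible g_pos g_lip hε hlt
  have hε' : ε⁻¹ ≠ 0 := inv_ne_zero hε.ne'
  have qA := quasiMeasurePreserving_smul_Rn (d := n + 1) hε'
  -- Null sets of the base pull back to null sets of the interface under x ↦ x'/ε, so the bounds on
  -- h hold almost everywhere for the surface measure.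
  have qh := (quasiMeasurePreserving_smul_Rn (d := n) hε').comp H.quasiMeasurePreserving_horiz
  have hA_ε : ∀ᵐ x ∂(volume.restrict (cyl ω ℓ \ interface ω ℓ g k ε)), ∀ ξ : Rn (n + 1),
      α * ‖ξ‖ ^ 2 ≤ inner ℝ ((A (ε⁻¹ • x)).toEuclideanLin ξ) ξ ∧
        ‖(A (ε⁻¹ • x)).toEuclideanLin ξ‖ ≤ β * ‖ξ‖ := ae_restrict_of_ae (qA.ae hA_all)
  have hh_ε : ∀ᵐ x ∂(surf (interface ω ℓ g k ε)), h₀ < h (ε⁻¹ • horiz x) := qh.ae hh_all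
  have hβ_ε : ∀ᵐ x ∂(surf (interface ω ℓ g k ε)), ‖h (ε⁻¹ • horiz x)‖ ≤ β' := qh.ae hβ'
  obtain ⟨MA, hMA⟩ := exists_multiplication_clm
    (μ := volume.restrict (cyl ω ℓ \ interface ω ℓ g k ε))
    (fun x => (A (ε⁻¹ • x)).toEuclideanLin)
    (fun F hF => aestronglyMeasurable_toEuclideanLin
      (fun i j => ((A_meas i j).comp_quasiMeasurePreserving qA).restrict) hF)
    (hA_ε.mono fun x hx ξ => (hx ξ).2)
  obtain ⟨Mh, hMh⟩ := exists_multiplication_clm (μ := surf (interface ω ℓ g k ε))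
    (fun x => h (ε⁻¹ • horiz x) • (LinearMap.id : ℝ →ₗ[ℝ] ℝ))
    (fun J hJ => (h_mem.1.comp_quasiMeasurePreserving qh).smul hJ)
    (hβ_ε.mono fun x hx y => by
      simp only [LinearMap.smul_apply, LinearMap.id_apply, norm_smul]; gcongr)
  obtain ⟨u, hu, huniq, b1, b2⟩ := exists_isWeakSolution (γ := γ) H hε f hMA hMh hα h₀_pos
    (fun F => le_inner_of_ae <| by
      filter_upwards [hMA F, hA_ε] with x h1 h2
      rw [h1]; exact (h2 _).1)
    (fun J => le_inner_of_ae <| by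
      filter_upwards [hMh J, hh_ε] with x h1 h2
      rw [h1]
      simp only [LinearMap.smul_apply, LinearMap.id_apply, smul_eq_mul, RCLike.inner_apply,
        conj_trivial, Real.norm_eq_abs, sq_abs]
      nlinarith [mul_nonneg (sub_nonneg.2 h2.le) (sq_nonneg (J x))])
  refine ⟨u, hu, huniq, b1.trans (ENNReal.ofReal_le_ofReal ?_),
    b2.trans (ENNReal.ofReal_le_ofReal ?_)⟩
  · nlinarith [mul_nonneg hs hD]
  · gcongr
    linarith
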